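/- Let $\alpha,\eta,\theta,R$ be real $N\times N$ matrices with $\alpha=\alpha^{T}>0$, $\eta=\eta^{T}>0$ (the duality condition), $\theta^{T}=-\theta$, $R=R^{T}\ge 0$ and $N_R=\operatorname{rank}R>0$. For complex $\beta$ let $A(\beta)=\Omega-\mathrm{i}\beta B$ be the system operator on $\mathbb{C}^{2N}$ of $\alpha\ddot Q+(2\theta+\beta R)\dot Q+\eta Q=0$, where $$\Omega=\begin{bmatrix}-2\mathrm{i}K_{\mathrm p}\theta K_{\mathrm p}^{T}&-\mathrm{i}\Phi^{T}\\ \mathrm{i}\Phi&0\end{bmatrix},\quad B=\begin{bmatrix}K_{\mathrm p}RK_{\mathrm p}^{T}&0\\0&0\end{bmatrix},\quad K_{\mathrm p}=\sqrt{\alpha}^{\,-1},\ \Phi=\sqrt{\eta}\,K_{\mathrm p}^{T}.$$ Let $\omega_{\max}$ be the largest eigenvalue of $\Omega$ and let $b_1,\dots,b_{N_R}$ be the nonzero eigenvalues of $B$, repeated according to multiplicity, with $b_0=0$. Denote by $\Omega^{\flat},B^{\flat},\omega_{\max}^{\flat},b_j^{\flat}$ the same objects for the dual system, obtained by interchanging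 $\alpha$ and $\eta$. Assume the generic condition for both systems: $b_1,\dots,b_{N_R}$ are distinct and $b_1^{\flat},\dots,b_{N_R}^{\flat}$ are distinct. Put $$d=\min_{0\le i,j\le N_R,\ i\ne j}|b_i-b_j|,\quad d^{\flat}=\min_{0\le i,j\le N_R,\ i\ne j}|b_i^{\flat}-b_j^{\flat}|,\quad \beta_0=\frac{2\omega_{\max}}{d},\quad \beta_1=\max\Big\{\beta_0,\frac{2\omega_{\max}^{\flat}}{d^{\flat}}\Big\}.$$ (1) The high-loss eigenvalues $\zeta_1(\beta),\dots,\zeta_{N_R}(\beta)$ of $A(\beta)$, i.e. those eigenvalues (counted with algebraic multiplicity) that tend to infinity in modulus as $\beta\to+\infty$, the others staying bounded, are meromorphic in $z=\beta^{-1}$ at $z=0$, and are analytic in the punctured disc $0<|z|<\beta_0^{-1}$, where they are simple eigenvalues of $A(z^{-1})$. Their eigenprojections $P_j$ extend analytically to the whole disc $|z|<\beta_0^{-1}$ and have rank one there. If $\beta>\beta_0$ then $\operatorname{Re}\zeta_j(\beta)=0$ for $1\le j\le N_R$. (2) The low-loss/low-Q eigenvalues $\zeta_{N_R+1}(\beta),\dots,\zeta_{2N_R}(\beta)$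 of $A(\beta)$, i.e. those eigenvalues (counted with algebraic multiplicity) that tend to $0$ as $\beta\to+\infty$, the others staying away from $0$, are analytic in $z=\beta^{-1}$ in the disc $|z|<\beta_1^{-1}$ (with value $0$ at $z=0$). Their eigenprojections $P_j$ extend analytically to this disc, including $z=0$, and have rank one there; for $0<|z|<\beta_1^{-1}$ the eigenvalues are simple eigenvalues of $A(z^{-1})$. In particular, if $\beta>\beta_1$ then $\zeta_{N_R+1}(\beta),\dots,\zeta_{2N_R}(\beta)$ are simple eigenvalues of $A(\beta)$ and $\operatorname{Re}\zeta_j(\beta)=0$ for $N_R+1\le j\le 2N_R$. -/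

import Mathlib

open Matrix Filter Topology
open scoped MatrixOrder

noncomputable section

/-- A linear Lagrangian system `α Q'' + (2 θ + β R) Q' + η Q = 0` with `N` degrees of freedom:
the real matrices `α, η, θ, R` satisfy `α = αᵀ > 0`, `η = ηᵀ ≥ 0`, `θᵀ = -θ`, `R = Rᵀ ≥ 0`, and
`R` has positive rank. -/
structure LagrangianSystem (N : ℕ) where
  α : Matrix (Fin N) (Fin N) ℝ
  η : Matrix (Fin N) (Fin N) ℝ
  θ : Matrix (Fin N) (Fin N) ℝ
  R : Matrix (Fin N) (Fin N) ℝ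
  α_pos : α.PosDef
  η_nonneg : η.PosSemidef
  θ_skew : θᵀ = -θ
  R_nonneg : R.PosSemidef
  R_rank_pos : 0 < R.rank

namespace LagrangianSystem

variable {N : ℕ}

/-- The dual system, obtained by interchanging `α` and `η`; it is defined when `η > 0`. -/
def dual (S : LagrangianSystem N) (hη : S.η.PosDef) : LagrangianSystem N where
  α := S.η
  η := S.α
  θ := S.θ
  R := S.R
  α_pos := hη
  η_nonneg := S.α_pos.posSemidef
  θ_skew := S.θ_skew
  R_nonneg := S.R_nonneg
  R_rank_pos := S.R_rank_pos

/-- `N_R = rank R`. -/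
def rankR (S : LagrangianSystem N) : ℕ := S.R.rank

/-- `K_p = (√α)⁻¹`, with `√α` the positive definite square root. -/
def Kp (S : LagrangianSystem N) : Matrix (Fin N) (Fin N) ℝ := (CFC.sqrt S.α)⁻¹

/-- `K_q = √η`, the positive semidefinite square root. -/
def Kq (S : LagrangianSystem N) : Matrix (Fin N) (Fin N) ℝ := CFC.sqrt S.η

/-- `Φ = K_q K_pᵀ`. -/
def Phi (S : LagrangianSystem N) : Matrix (Fin N) (Fin N) ℝ := S.Kq * S.Kpᵀ

/-- The frequency operator
`Ω = [[-2i K_p θ K_pᵀ, -i Φᵀ], [i Φ, 0]]`. -/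
def Omega (S : LagrangianSystem N) : Matrix (Fin N ⊕ Fin N) (Fin N ⊕ Fin N) ℂ :=
  Matrix.fromBlocks
    ((-2 * Complex.I) • (S.Kp * S.θ * S.Kpᵀ).map Complex.ofReal)
    ((-Complex.I) • S.Phiᵀ.map Complex.ofReal)
    (Complex.I • S.Phi.map Complex.ofReal)
    0

/-- The power dissipation operator `B = [[K_p R K_pᵀ, 0], [0, 0]]`. -/
def B (S : LagrangianSystem N) : Matrix (Fin N ⊕ Fin N) (Fin N ⊕ Fin N) ℂ :=
  Matrix.fromBlocks ((S.Kp * S.R * S.Kpᵀ).map Complex.ofReal) 0 0 0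

/-- The system operator `A(β) = Ω - i β B`, for complex `β`. -/
def A (S : LagrangianSystem N) (β : ℂ) : Matrix (Fin N ⊕ Fin N) (Fin N ⊕ Fin N) ℂ :=
  S.Omega - (Complex.I * β) • S.B

/-- `ω_max`, the largest eigenvalue of the Hermitian matrix `Ω`. -/
def omegaMax (S : LagrangianSystem N) : ℝ :=
  sSup {ω : ℝ | (ω : ℂ) ∈ spectrum ℂ S.Omega}

/-- `B₂`, the restriction of `B` to its range (the loss subspace). -/
def B₂ (S : LagrangianSystem N) :
    LinearMap.range (Matrix.toLin' S.B) →ₗ[ℂ] LinearMap.range (Matrix.toLin' S.B) :=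
  (Matrix.toLin' S.B).restrict (fun x _ => LinearMap.mem_range_self (Matrix.toLin' S.B) x)

/-- The generic condition: the eigenvalues `b₁, …, b_{N_R}` of `B₂`, repeated according to
multiplicity, are distinct. -/
def Generic (S : LagrangianSystem N) : Prop := S.B₂.charpoly.roots.Nodup

/-- `d`, the minimal distance between two different eigenvalues of `B` (including `b₀ = 0`). -/
def gap (S : LagrangianSystem N) : ℝ :=
  sInf {x : ℝ | ∃ b ∈ spectrum ℂ S.B, ∃ b' ∈ spectrum ℂ S.B, b ≠ b' ∧ x = ‖b - b'‖}

/-- `β₀ = 2 ω_max / d`. -/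
def beta0 (S : LagrangianSystem N) : ℝ := 2 * S.omegaMax / S.gap

/-- `β₁ = max {β₀, 2 ω♭_max / d♭}`. -/
def beta1 (S : LagrangianSystem N) (hη : S.η.PosDef) : ℝ :=
  max S.beta0 (2 * (S.dual hη).omegaMax / (S.dual hη).gap)

/-- The functions `ζ j` of `z = β⁻¹` are the high-loss eigenvalues, counted with algebraic
multiplicity: as `β → ∞` they tend to infinity in modulus, and all other eigenvalues of `A(β)`
stay bounded. -/
def IsHighLossFamily (S : LagrangianSystem N) {n : ℕ} (ζ : Fin n → ℂ → ℂ) : Prop :=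
  (∀ j, Tendsto (fun β : ℝ => ‖ζ j ((β : ℂ)⁻¹)‖) atTop atTop) ∧
  ∃ r : ℝ, ∀ᶠ β : ℝ in atTop,
    (S.A (β : ℂ)).charpoly.roots.filter (fun x => r < ‖x‖)
      = Finset.univ.val.map (fun j => ζ j ((β : ℂ)⁻¹))

/-- The functions `ζ j` of `z = β⁻¹` are the low-loss/low-Q eigenvalues, counted with algebraic
multiplicity: as `β → ∞` they tend to `0`, and all other eigenvalues of `A(β)` stay away
from `0`. -/
def IsLowLossLowQFamily (S : LagrangianSystem N) {n : ℕ} (ζ : Fin n → ℂ → ℂ) : Prop :=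
  (∀ j, Tendsto (fun β : ℝ => ζ j ((β : ℂ)⁻¹)) atTop (𝓝 0)) ∧
  ∃ r : ℝ, 0 < r ∧ ∀ᶠ β : ℝ in atTop,
    (S.A (β : ℂ)).charpoly.roots.filter (fun x => ‖x‖ < r)
      = Finset.univ.val.map (fun j => ζ j ((β : ℂ)⁻¹))

end LagrangianSystem

/-- `x` is a simple eigenvalue of `M` (algebraic multiplicity one). -/
def IsSimpleEigenvalue {n : Type*} [Fintype n] [DecidableEq n] (M : Matrix n n ℂ) (x : ℂ) : Prop :=
  M.charpoly.rootMultiplicity x = 1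

/-- `P` is the eigenprojection of `M` for the eigenvalue `x`: the projection commuting with `M`
whose range is the algebraic (generalized) eigenspace. -/
def IsEigenprojection {n : Type*} [Fintype n] [DecidableEq n]
    (M : Matrix n n ℂ) (x : ℂ) (P : Matrix n n ℂ) : Prop :=
  P * P = P ∧ M * P = P * M ∧
  LinearMap.range (Matrix.toLin' P) = Module.End.maxGenEigenspace (Matrix.toLin' M) x

end

/-!
The pencil `B + z i Ω = i z A(z⁻¹)` is an analytic perturbation of the Hermitian matrix `B`, of norm
`|z| ‖Ω‖ = |z| ω_max < d / 2` when `|z| < β₀⁻¹`. By the Bauer–Fike estimate no eigenvalue then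
crosses the circle of radius `d / 2` about `b_j`, so by the argument principle that circle encloses
exactly one eigenvalue `μ_j(z)`, which is simple and hence analytic in `z`, together with its
eigenprojection; the eigenvalues left over are at most `|z| ω_max`. Therefore `ζ_j = -i z⁻¹ μ_j(z)`
are the high-loss eigenvalues. For real `z` the pencil is a real matrix and `b_j` is real, so
`μ_j(z)`, being the only eigenvalue in its disc, is its own conjugate: `ζ_j` is imaginary.

Exchanging the two blocks of the dual operator `A♭(β)` gives `-A(β)⁻¹`. Hence the low-loss/low-Q
eigenvalues of `A(β)` are `-1 / ζ♭`, where `ζ♭` runs over the high-loss eigenvalues of `A♭(β)`.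
-/

noncomputable section

section SimpleEigenvalues

variable {n m : Type*} [Fintype n] [DecidableEq n] [Fintype m] [DecidableEq m]
  {M M' P : Matrix n n ℂ} {x : ℂ}

lemma isSimpleEigenvalue_iff_count : IsSimpleEigenvalue M x ↔ M.charpoly.roots.count x = 1 := by
  rw [IsSimpleEigenvalue, Polynomial.count_roots]

lemma mem_roots_charpoly : x ∈ M.charpoly.roots ↔ x ∈ spectrum ℂ M := by
  rw [Polynomial.mem_roots M.charpoly_monic.ne_zero, Matrix.mem_spectrum_iff_isRoot_charpoly]

lemma IsSimpleEigenvalue.isRoot (h : IsSimpleEigenvalue M x) : M.charpoly.IsRoot x :=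
  Polynomial.isRoot_of_mem_roots <|
    Multiset.count_pos.1 <| by rw [isSimpleEigenvalue_iff_count.1 h]; exact one_pos

lemma IsSimpleEigenvalue.derivative_ne_zero (h : IsSimpleEigenvalue M x) :
    M.charpoly.derivative.eval x ≠ 0 := fun h0 =>
  ((Polynomial.one_lt_rootMultiplicity_iff_isRoot M.charpoly_monic.ne_zero).2
    ⟨h.isRoot, h0⟩).ne' h

lemma card_roots_charpoly (M : Matrix n n ℂ) :
    Multiset.card M.charpoly.roots = Fintype.card n := by
  rw [← (IsAlgClosed.splits M.charpoly).natDegree_eq_card_roots, M.charpoly_natDegree_eq_dim]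

lemma finrank_maxGenEigenspace_toLin' (M : Matrix n n ℂ) (x : ℂ) :
    Module.finrank ℂ (Module.End.maxGenEigenspace (Matrix.toLin' M) x)
      = M.charpoly.roots.count x := by
  rw [LinearMap.finrank_maxGenEigenspace_eq, Matrix.charpoly_toLin', Polynomial.count_roots]

/-- `P` is a nonzero projection with `M P = P M = x P`, where `x` is a simple eigenvalue of `M`.
This determines `P`, and is easier to transport between matrices than `IsEigenprojection`. -/
structure IsSimpleEigenprojection (M : Matrix n n ℂ) (x : ℂ) (P : Matrix n n ℂ) : Prop where
  isSimpleEigenvalue : IsSimpleEigenvalue M x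
  mul_self : P * P = P
  ne_zero : P ≠ 0
  mul_left : M * P = x • P
  mul_right : P * M = x • P

namespace IsSimpleEigenprojection

lemma range_toLin' (h : IsSimpleEigenprojection M x P) :
    LinearMap.range (Matrix.toLin' P) = Module.End.maxGenEigenspace (Matrix.toLin' M) x := by
  refine Submodule.eq_of_le_of_finrank_le ?_ ?_
  · rintro _ ⟨v, rfl⟩
    refine Module.End.genEigenspace_le_maximal _ _ 1 (Module.End.mem_eigenspace_iff.2 ?_)
    simp only [Matrix.toLin'_apply, Matrix.mulVec_mulVec, h.mul_left, Matrix.smul_mulVec]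
  · rw [finrank_maxGenEigenspace_toLin', isSimpleEigenvalue_iff_count.1 h.isSimpleEigenvalue,
      Submodule.one_le_finrank_iff, Ne, LinearMap.range_eq_bot, LinearEquiv.map_eq_zero_iff]
    exact h.ne_zero

lemma isEigenprojection (h : IsSimpleEigenprojection M x P) : IsEigenprojection M x P :=
  ⟨h.mul_self, h.mul_left.trans h.mul_right.symm, h.range_toLin'⟩

lemma rank_eq_one (h : IsSimpleEigenprojection M x P) : P.rank = 1 := by
  rw [Matrix.rank, ← Matrix.toLin'_apply', h.range_toLin', finrank_maxGenEigenspace_toLin',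
    isSimpleEigenvalue_iff_count.1 h.isSimpleEigenvalue]

lemma reindex (h : IsSimpleEigenprojection M x P) (e : n ≃ m) :
    IsSimpleEigenprojection (Matrix.reindexAlgEquiv ℂ ℂ e M) x
      (Matrix.reindexAlgEquiv ℂ ℂ e P) where
  isSimpleEigenvalue := by
    rw [IsSimpleEigenvalue, Matrix.coe_reindexAlgEquiv, Matrix.charpoly_reindex]
    exact h.isSimpleEigenvalue
  mul_self := by rw [← map_mul, h.mul_self]
  ne_zero := by simpa only [Ne, EmbeddingLike.map_eq_zero_iff] using h.ne_zero
  mul_left := by rw [← map_mul, h.mul_left, map_smul]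
  mul_right := by rw [← map_mul, h.mul_right, map_smul]

end IsSimpleEigenprojection

/-- For a simple eigenvalue `x` of `M`, the eigenprojection `q(M) / q(x)`, where `q` is the
characteristic polynomial of `M` divided by `X - x`. -/
def eigenprojection (M : Matrix n n ℂ) (x : ℂ) : Matrix n n ℂ :=
  (M.charpoly.derivative.eval x)⁻¹ •
    Polynomial.aeval M (M.charpoly /ₘ (Polynomial.X - Polynomial.C x))

lemma aeval_mul_aeval_divByMonic_charpoly (hx : M.charpoly.IsRoot x) (p : Polynomial ℂ) :
    Polynomial.aeval M p
        * Polynomial.aeval M (M.charpoly /ₘ (Polynomial.X - Polynomial.C x))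
      = p.eval x • Polynomial.aeval M (M.charpoly /ₘ (Polynomial.X - Polynomial.C x)) := by
  set q := M.charpoly /ₘ (Polynomial.X - Polynomial.C x)
  have hmul : (Polynomial.X - Polynomial.C x) * q = M.charpoly :=
    Polynomial.mul_divByMonic_eq_iff_isRoot.2 hx
  obtain ⟨r, hr⟩ := Polynomial.X_sub_C_dvd_sub_C_eval (p := p) (a := x)
  have hpq : p * q = Polynomial.C (p.eval x) * q + r * M.charpoly := by
    linear_combination q * hr + r * hmul
  rw [← map_mul, hpq, map_add, map_mul, map_mul, Matrix.aeval_self_charpoly, mul_zero, add_zero,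
    Polynomial.aeval_C, ← Algebra.smul_def]

lemma eval_divByMonic_charpoly (hx : M.charpoly.IsRoot x) :
    (M.charpoly /ₘ (Polynomial.X - Polynomial.C x)).eval x = M.charpoly.derivative.eval x := by
  conv_rhs => rw [← Polynomial.mul_divByMonic_eq_iff_isRoot.2 hx]
  simp

lemma IsSimpleEigenvalue.isSimpleEigenprojection (h : IsSimpleEigenvalue M x) :
    IsSimpleEigenprojection M x (eigenprojection M x) := by
  rw [eigenprojection, ← eval_divByMonic_charpoly h.isRoot]
  have haeval := aeval_mul_aeval_divByMonic_charpoly h.isRoot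
  have hqx : (M.charpoly /ₘ (Polynomial.X - Polynomial.C x)).eval x ≠ 0 :=
    (eval_divByMonic_charpoly h.isRoot).trans_ne h.derivative_ne_zero
  set q := M.charpoly /ₘ (Polynomial.X - Polynomial.C x)
  have hMq : M * Polynomial.aeval M q = x • Polynomial.aeval M q := by
    simpa only [Polynomial.aeval_X, Polynomial.eval_X] using haeval Polynomial.X
  have hqM : Polynomial.aeval M q * M = x • Polynomial.aeval M q := by
    simpa only [map_mul, Polynomial.aeval_X, hMq] using
      congrArg (Polynomial.aeval M) (mul_comm q Polynomial.X)
  have hne : Polynomial.aeval M q ≠ 0 := fun h0 => by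
    have hmem : q.eval x ∈ spectrum ℂ (Polynomial.aeval M q) :=
      spectrum.subset_polynomial_aeval M q
        ⟨x, Matrix.mem_spectrum_iff_isRoot_charpoly.2 h.isRoot, rfl⟩
    rw [h0, spectrum.mem_iff, sub_zero] at hmem
    exact hmem ((IsUnit.mk0 _ hqx).map (algebraMap ℂ _))
  refine ⟨h, ?_, smul_ne_zero (inv_ne_zero hqx) hne, ?_, ?_⟩
  · rw [smul_mul_smul_comm, haeval, smul_smul, mul_assoc, inv_mul_cancel₀ hqx, mul_one]
  · rw [mul_smul_comm, hMq, smul_comm]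
  · rw [smul_mul_assoc, hqM, smul_comm]

/-- `M'` behaves like a function `f` of `M` as far as spectra are concerned: `f` is injective and
`M - x` divides `M' - f x` in the commutant of `M`, for every eigenvalue `x` of `M`. -/
structure IsSpectralImage (f : ℂ → ℂ) (M M' : Matrix n n ℂ) : Prop where
  injective : Function.Injective f
  exists_factor : ∀ x ∈ spectrum ℂ M, ∃ L, Commute L M ∧
    M' - algebraMap ℂ _ (f x) = L * (M - algebraMap ℂ _ x)

lemma isSpectralImage_smul {c : ℂ} (hc : c ≠ 0) (M : Matrix n n ℂ) :
    IsSpectralImage (c * ·) M (c • M) where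
  injective := mul_right_injective₀ hc
  exists_factor x _ := ⟨algebraMap ℂ _ c, Algebra.commute_algebraMap_left c M, by
    rw [mul_sub, ← map_mul, Algebra.smul_def]⟩

lemma isSpectralImage_neg_inv (h : M' * M = -1) : IsSpectralImage (fun x => -x⁻¹) M M' where
  injective := neg_injective.comp inv_injective
  exists_factor x hx := by
    have h' : -M' * M = 1 := by rw [neg_mul, h, neg_neg]
    have hx0 : x ≠ 0 := by
      rintro rfl
      exact spectrum.zero_notMem ℂ (IsUnit.of_mul_eq_one_right _ h') hx
    refine ⟨-x⁻¹ • M', ?_, ?_⟩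
    · refine Commute.smul_left ?_ _
      rw [← Commute.neg_left_iff, commute_iff_eq, h', mul_eq_one_comm.1 h']
    · rw [smul_mul_assoc, mul_sub, h, Algebra.algebraMap_eq_smul_one,
        Algebra.algebraMap_eq_smul_one, mul_smul_comm, mul_one, smul_sub, smul_smul, neg_mul,
        inv_mul_cancel₀ hx0]
      module

namespace IsSpectralImage

variable {f : ℂ → ℂ}

lemma maxGenEigenspace_le (h : IsSpectralImage f M M') (hx : x ∈ spectrum ℂ M) :
    Module.End.maxGenEigenspace (Matrix.toLin' M) x ≤
      Module.End.maxGenEigenspace (Matrix.toLin' M') (f x) := by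
  obtain ⟨L, hL, hM'⟩ := h.exists_factor x hx
  have hcomm : Commute L (M - algebraMap ℂ _ x) :=
    hL.sub_right (Algebra.commute_algebraMap_right x L)
  have hlin (T : Matrix n n ℂ) (y : ℂ) : Matrix.toLin' T - y • (1 : Module.End ℂ (n → ℂ))
      = Matrix.toLinAlgEquiv' (T - algebraMap ℂ _ y) := by
    rw [map_sub, AlgEquiv.commutes, Algebra.algebraMap_eq_smul_one]
    rfl
  intro v hv
  rw [Module.End.mem_maxGenEigenspace] at hv ⊢
  obtain ⟨k, hk⟩ := hv
  refine ⟨k, ?_⟩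
  rw [hlin, ← map_pow] at hk ⊢
  rw [hM', hcomm.mul_pow, map_mul, Module.End.mul_apply, hk, map_zero]

/-- Multiplicities can only increase from `M` to `M'`, and both sides have `card n` elements. -/
lemma roots_charpoly (h : IsSpectralImage f M M') :
    M'.charpoly.roots = M.charpoly.roots.map f := by
  refine (Multiset.eq_of_le_of_card_le (Multiset.le_iff_count.2 fun y => ?_) ?_).symm
  · by_cases hy : y ∈ M.charpoly.roots.map f
    · obtain ⟨x, hx, rfl⟩ := Multiset.mem_map.1 hy
      rw [Multiset.count_map_eq_count' f _ h.injective, ← finrank_maxGenEigenspace_toLin',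
        ← finrank_maxGenEigenspace_toLin']
      exact Submodule.finrank_mono (h.maxGenEigenspace_le (mem_roots_charpoly.1 hx))
    · rw [Multiset.count_eq_zero_of_notMem hy]
      exact Nat.zero_le _
  · rw [Multiset.card_map, card_roots_charpoly, card_roots_charpoly]

lemma isSimpleEigenprojection (h : IsSpectralImage f M M') (hP : IsSimpleEigenprojection M x P) :
    IsSimpleEigenprojection M' (f x) P := by
  have hx : x ∈ spectrum ℂ M :=
    Matrix.mem_spectrum_iff_isRoot_charpoly.2 hP.isSimpleEigenvalue.isRoot
  obtain ⟨L, hL, hM'⟩ := h.exists_factor x hx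
  refine ⟨?_, hP.mul_self, hP.ne_zero, ?_, ?_⟩
  · rw [isSimpleEigenvalue_iff_count, h.roots_charpoly,
      Multiset.count_map_eq_count' f _ h.injective,
      isSimpleEigenvalue_iff_count.1 hP.isSimpleEigenvalue]
  · rw [← sub_eq_zero, Algebra.smul_def, ← sub_mul, hM', mul_assoc, sub_mul, hP.mul_left,
      ← Algebra.smul_def, sub_self, mul_zero]
  · rw [← sub_eq_zero, Algebra.smul_def, Algebra.commutes, ← mul_sub, hM',
      (hL.sub_right (Algebra.commute_algebraMap_right x L)).eq, ← mul_assoc, mul_sub, hP.mul_right,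
      Algebra.smul_def, Algebra.commutes, sub_self, zero_mul]

end IsSpectralImage

end SimpleEigenvalues
section BauerFike

/-- The Bauer–Fike bound: the inverse of `x - a` has norm `1 / dist (x, σ(a))`, so that `x - a - c`
stays invertible as long as `‖c‖` is smaller than that distance. -/
lemma exists_mem_spectrum_norm_sub_le {A : Type*} [CStarAlgebra A] {a c : A} [IsStarNormal a]
    {x : ℂ} (hx : x ∈ spectrum ℂ (a + c)) : ∃ y ∈ spectrum ℂ a, ‖x - y‖ ≤ ‖c‖ := by
  by_contra! hfar
  have hne : ∀ y ∈ spectrum ℂ a, x - y ≠ 0 := fun y hy =>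
    norm_pos_iff.1 ((norm_nonneg c).trans_lt (hfar y hy))
  have hcont : ContinuousOn (fun y => (x - y)⁻¹) (spectrum ℂ a) :=
    ContinuousOn.inv₀ (by fun_prop) hne
  set r := cfc (fun y => (x - y)⁻¹) a with hr
  have hinv : r * (algebraMap ℂ A x - a) = 1 := by
    have hsub : algebraMap ℂ A x - a = cfc (fun y => x - y) a := by
      rw [cfc_sub .., cfc_const .., cfc_id' ℂ a]
    rw [hsub, hr, ← cfc_mul .., ← cfc_one ℂ a]
    exact cfc_congr fun y hy => inv_mul_cancel₀ (hne y hy)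
  have hcr : ‖c * r‖ < 1 := by
    refine (norm_mul_le c r).trans_lt ?_
    rcases (norm_nonneg c).eq_or_lt with hc | hc
    · rw [← hc, zero_mul]; exact one_pos
    · rw [← lt_inv_mul_iff₀ hc, mul_one]
      refine norm_cfc_lt (inv_pos.2 hc) fun y hy => ?_
      rw [norm_inv]
      exact inv_strictAnti₀ hc (hfar y hy)
  have hunit : IsUnit (algebraMap ℂ A x - a) :=
    spectrum.notMem_iff.1 fun hxa => hne x hxa (sub_self x)
  refine spectrum.mem_iff.1 hx ?_
  have hfactor : algebraMap ℂ A x - (a + c) = (1 - c * r) * (algebraMap ℂ A x - a) := by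
    rw [sub_mul, one_mul, mul_assoc, hinv, mul_one, sub_sub]
  rw [hfactor]
  exact (isUnit_one_sub_of_norm_lt_one hcr).mul hunit

end BauerFike
section AnalyticFunctions

lemma analyticAt_of_eventually_unique {E : Type*} [NormedAddCommGroup E] [NormedSpace ℂ E]
    [CompleteSpace E] {f : E × ℂ → ℂ} {g : E → ℂ} {z : E} (hf : AnalyticAt ℂ f (z, g z))
    (hderiv : deriv (fun y => f (z, y)) (g z) ≠ 0) {V : Set ℂ} (hV : V ∈ 𝓝 (g z))
    (hunique : ∀ᶠ w in 𝓝 z, ∀ y ∈ V, f (w, y) = f (z, g z) → y = g w) : AnalyticAt ℂ g z := by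
  have hcd : ContDiffAt ℂ ⊤ f (z, g z) := hf.contDiffAt
  have hpartial : fderiv ℂ f (z, g z) ∘L .inr ℂ E ℂ
      = ContinuousLinearMap.toSpanSingleton ℂ (deriv (fun y => f (z, y)) (g z)) := by
    ext
    have := (hf.differentiableAt.hasFDerivAt.comp (g z) (hasFDerivAt_prodMk_right z (g z)))
    simpa using! this.hasDerivAt.deriv.symm
  have hinv : (fderiv ℂ f (z, g z) ∘L .inr ℂ E ℂ).IsInvertible :=
    ⟨ContinuousLinearEquiv.unitsEquivAut ℂ (Units.mk0 _ hderiv), by rw [hpartial]; ext; simp⟩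
  have hψ := hcd.contDiffAt_implicitFunction (by simp) hinv
  have htendsto : Tendsto (hcd.implicitFunction (by simp) hinv) (𝓝 z) (𝓝 (g z)) := by
    simpa only [hcd.implicitFunction_apply_self (by simp) hinv] using hψ.continuousAt.tendsto
  refine hψ.analyticAt.congr ?_
  filter_upwards [hunique, htendsto hV, hcd.eventually_apply_implicitFunction (by simp) hinv]
    with w hw hwV hwf using hw _ hwV hwf

end AnalyticFunctions

section PolynomialFamilies

open Metric Polynomial

variable {X : Type*} [TopologicalSpace X] {d : ℕ}

lemma continuous_eval_of_continuous_coeff {p : X → ℂ[X]} {g : X → ℂ}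
    (hdeg : ∀ x, (p x).natDegree ≤ d) (hp : ∀ k, Continuous fun x => (p x).coeff k)
    (hg : Continuous g) : Continuous fun x => (p x).eval (g x) := by
  simp only [fun x => eval_eq_sum_range' (Nat.lt_succ_of_le (hdeg x)) (g x)]
  fun_prop

lemma analyticAt_eval_of_analyticAt_coeff {E : Type*} [NormedAddCommGroup E] [NormedSpace ℂ E]
    {p : E → ℂ[X]} {g : E → ℂ} {z : E} (hdeg : ∀ x, (p x).natDegree ≤ d)
    (hp : ∀ k, AnalyticAt ℂ (fun x => (p x).coeff k) z) (hg : AnalyticAt ℂ g z) :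
    AnalyticAt ℂ (fun x => (p x).eval (g x)) z := by
  simp only [fun x => eval_eq_sum_range' (Nat.lt_succ_of_le (hdeg x)) (g x)]
  exact Finset.analyticAt_fun_sum _ fun k _ => (hp k).mul (hg.pow k)

variable {c w : ℂ} {r : ℝ}

lemma circleIntegral_sub_inv (hr : 0 ≤ r) (hw : w ∉ sphere c r) :
    (∮ x in C(c, r), (x - w)⁻¹) = if dist w c < r then 2 * Real.pi * Complex.I else 0 := by
  split_ifs with h
  · exact circleIntegral.integral_sub_inv_of_mem_ball h
  · have hne : ∀ x ∈ closedBall c r, x - w ≠ 0 := fun x hx h0 => by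
      rw [sub_eq_zero] at h0
      rcases (mem_closedBall.1 (h0 ▸ hx)).lt_or_eq with hlt | heq
      exacts [h hlt, hw heq]
    exact Complex.circleIntegral_eq_zero_of_differentiable_on_off_countable hr
      Set.countable_empty (ContinuousOn.inv₀ (by fun_prop) hne)
      fun x hx => DifferentiableAt.inv (by fun_prop) (hne x (ball_subset_closedBall hx.1))

lemma circleIntegrable_sub_inv (hr : 0 ≤ r) (hw : w ∉ sphere c r) :
    CircleIntegrable (fun x => (x - w)⁻¹) c r :=
  ContinuousOn.circleIntegrable hr <|
    ContinuousOn.inv₀ (by fun_prop) fun _ hx => sub_ne_zero.2 (ne_of_mem_of_not_mem hx hw)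

lemma circleIntegral_sum_sub_inv (hr : 0 ≤ r) (s : Multiset ℂ) (hs : ∀ w ∈ s, w ∉ sphere c r) :
    CircleIntegrable (fun x => (s.map fun w => (x - w)⁻¹).sum) c r ∧
      (∮ x in C(c, r), (s.map fun w => (x - w)⁻¹).sum)
        = 2 * Real.pi * Complex.I * (s.countP (dist · c < r) : ℕ) := by
  induction s using Multiset.induction with
  | empty => simp [circleIntegral]
  | cons w s ih =>
    obtain ⟨hint, hsum⟩ := ih fun v hv => hs v (Multiset.mem_cons_of_mem hv)
    have hw := hs w (Multiset.mem_cons_self w s)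
    simp only [Multiset.map_cons, Multiset.sum_cons]
    refine ⟨(circleIntegrable_sub_inv hr hw).add hint, ?_⟩
    rw [circleIntegral.integral_add (circleIntegrable_sub_inv hr hw) hint, hsum,
      circleIntegral_sub_inv hr hw, Multiset.countP_cons]
    split_ifs <;> push_cast <;> ring

lemma circleIntegral_derivative_div {p : ℂ[X]} (hr : 0 ≤ r)
    (hp : ∀ x ∈ sphere c r, p.eval x ≠ 0) :
    (∮ x in C(c, r), p.derivative.eval x / p.eval x)
      = 2 * Real.pi * Complex.I * (p.roots.countP (dist · c < r) : ℕ) := by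
  rw [← (circleIntegral_sum_sub_inv hr p.roots fun w hw hwc =>
    hp w hwc (isRoot_of_mem_roots hw)).2]
  refine circleIntegral.integral_congr hr fun x hx => ?_
  simp only [(IsAlgClosed.splits p).eval_derivative_div_eval_of_ne_zero (hp x hx), one_div]

/-- The number of roots in the disc is the integer-valued continuous function given by the
argument principle. -/
lemma countP_roots_eq_of_preconnectedSpace [PreconnectedSpace X] {p : X → ℂ[X]}
    (hdeg : ∀ x, (p x).natDegree ≤ d) (hcoeff : ∀ k, Continuous fun x => (p x).coeff k)
    (hr : 0 ≤ r) (hsphere : ∀ x, ∀ w ∈ sphere c r, (p x).eval w ≠ 0) (x y : X) :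
    (p x).roots.countP (dist · c < r) = (p y).roots.countP (dist · c < r) := by
  refine PreconnectedSpace.constant ‹_› (f := fun x => (p x).roots.countP (dist · c < r))
    (Nat.isClosedEmbedding_coe_real.isEmbedding.continuous_iff.2 ?_)
  have hcircle : Continuous fun q : X × ℝ => circleMap c r q.2 := by fun_prop
  have heval : Continuous fun q : X × ℝ => (p q.1).eval (circleMap c r q.2) :=
    continuous_eval_of_continuous_coeff (fun q => hdeg q.1)
      (fun k => (hcoeff k).comp continuous_fst) hcircle
  have hderiv : Continuous fun q : X × ℝ => (p q.1).derivative.eval (circleMap c r q.2) := by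
    refine continuous_eval_of_continuous_coeff (d := d)
      (fun q => (natDegree_derivative_le _).trans ((Nat.sub_le _ _).trans (hdeg q.1)))
      (fun k => ?_) hcircle
    simp only [coeff_derivative]
    exact ((hcoeff _).comp continuous_fst).mul continuous_const
  have hintegral : Continuous fun x =>
      ∮ w in C(c, r), (p x).derivative.eval w / (p x).eval w := by
    refine intervalIntegral.continuous_parametric_intervalIntegral_of_continuous' ?_ _ _
    simp only [deriv_circleMap, Function.uncurry_def]
    have hvelocity : Continuous fun q : X × ℝ => circleMap 0 r q.2 * Complex.I := by fun_prop
    exact hvelocity.smul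
      (hderiv.div heval fun q => hsphere q.1 _ (circleMap_mem_sphere c hr q.2))
  have hcount : (fun x => (((p x).roots.countP (dist · c < r) : ℕ) : ℝ)) = fun x =>
      ((2 * Real.pi * Complex.I)⁻¹ *
        ∮ w in C(c, r), (p x).derivative.eval w / (p x).eval w).re := by
    funext x
    rw [circleIntegral_derivative_div hr (hsphere x),
      inv_mul_cancel_left₀ Complex.two_pi_I_ne_zero, Complex.natCast_re]
  rw [Function.comp_def, hcount]
  exact Complex.continuous_re.comp (continuous_const.mul hintegral)

end PolynomialFamilies
section AnalyticMatrixFamilies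

open Metric
open scoped Matrix.Norms.L2Operator

variable {n : Type*} [Fintype n] [DecidableEq n]

lemma coeff_charpoly_eq_aeval (T : Matrix n n ℂ) (k : ℕ) :
    T.charpoly.coeff k
      = MvPolynomial.aeval (fun ij : n × n => T ij.1 ij.2)
          ((Matrix.charpoly.univ ℂ n).coeff k) :=
  (Matrix.charpoly.univ_coeff_eval₂Hom n (RingHom.id ℂ) (fun ij : n × n => T ij.1 ij.2) k).symm

lemma continuous_coeff_charpoly (k : ℕ) :
    Continuous fun T : Matrix n n ℂ => T.charpoly.coeff k := by
  simp only [coeff_charpoly_eq_aeval]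
  exact (MvPolynomial.continuous_eval _).comp
    (continuous_pi fun ij => continuous_id.matrix_elem ij.1 ij.2)

variable {E : Type*} [NormedAddCommGroup E] [NormedSpace ℂ E] {T : E → Matrix n n ℂ} {g : E → ℂ}
  {z : E}

lemma analyticAt_matrix_apply (hT : AnalyticAt ℂ T z) (i j : n) :
    AnalyticAt ℂ (fun w => T w i j) z :=
  ((Matrix.entryLinearMap ℂ ℂ i j).toContinuousLinearMap.analyticAt _).comp hT

lemma analyticAt_coeff_charpoly (hT : AnalyticAt ℂ T z) (k : ℕ) :
    AnalyticAt ℂ (fun w => (T w).charpoly.coeff k) z := by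
  have happly (ij : n × n) : AnalyticAt ℂ (fun w => T w ij.1 ij.2) z :=
    analyticAt_matrix_apply hT ij.1 ij.2
  simp only [coeff_charpoly_eq_aeval]
  exact AnalyticAt.aeval_mvPolynomial happly _

lemma analyticAt_eval_charpoly (hT : AnalyticAt ℂ T z) (hg : AnalyticAt ℂ g z) :
    AnalyticAt ℂ (fun w => (T w).charpoly.eval (g w)) z :=
  analyticAt_eval_of_analyticAt_coeff (fun w => (T w).charpoly_natDegree_eq_dim.le)
    (analyticAt_coeff_charpoly hT) hg

lemma analyticAt_eval_derivative_charpoly (hT : AnalyticAt ℂ T z) (hg : AnalyticAt ℂ g z) :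
    AnalyticAt ℂ (fun w => (T w).charpoly.derivative.eval (g w)) z := by
  refine analyticAt_eval_of_analyticAt_coeff (d := Fintype.card n) (fun w => ?_) (fun k => ?_) hg
  · rw [← (T w).charpoly_natDegree_eq_dim]
    exact (Polynomial.natDegree_derivative_le _).trans (Nat.sub_le _ _)
  · simp only [Polynomial.coeff_derivative]
    exact (analyticAt_coeff_charpoly hT _).mul analyticAt_const

lemma analyticAt_eigenprojection (hT : AnalyticAt ℂ T z) (hg : AnalyticAt ℂ g z)
    (hsimple : IsSimpleEigenvalue (T z) (g z)) :
    AnalyticAt ℂ (fun w => eigenprojection (T w) (g w)) z := by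
  refine ((analyticAt_eval_derivative_charpoly hT hg).inv hsimple.derivative_ne_zero).smul ?_
  have hdeg (w : E) : ((T w).charpoly /ₘ (Polynomial.X - Polynomial.C (g w))).natDegree
      < Fintype.card n + 1 := by
    rw [Polynomial.natDegree_divByMonic _ (Polynomial.monic_X_sub_C _),
      (T w).charpoly_natDegree_eq_dim]
    omega
  simp only [fun w => Polynomial.aeval_eq_sum_range' (hdeg w) (T w),
    Polynomial.coeff_divByMonic_X_sub_C, Matrix.charpoly_natDegree_eq_dim]
  exact Finset.analyticAt_fun_sum _ fun k _ => AnalyticAt.smul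
    (Finset.analyticAt_fun_sum _ fun i _ => (hg.pow _).mul (analyticAt_coeff_charpoly hT i))
    (hT.pow k)

end AnalyticMatrixFamilies

section IsolatedEigenvalues

variable {n : Type*} [Fintype n] [DecidableEq n] {M T : Matrix n n ℂ} {b x : ℂ} {d : ℝ}

/-- The sum, with multiplicities, of the eigenvalues of `T` in the disc of radius `r` about `b`.
It serves as a choice-free name for the eigenvalue in that disc when there is only one. -/
def eigenvalueNear (T : Matrix n n ℂ) (b : ℂ) (r : ℝ) : ℂ :=
  (T.charpoly.roots.filter (dist · b < r)).sum

lemma eigenvalueNear_map_conj (T : Matrix n n ℂ) (b : ℂ) (r : ℝ) :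
    eigenvalueNear (T.map (starRingEnd ℂ)) (starRingEnd ℂ b) r
      = starRingEnd ℂ (eigenvalueNear T b r) := by
  have hroots : (T.map (starRingEnd ℂ)).charpoly.roots
      = T.charpoly.roots.map (starRingEnd ℂ) := by
    rw [Matrix.charpoly_map, (IsAlgClosed.splits T.charpoly).roots_map]
  rw [eigenvalueNear, hroots, Multiset.filter_map, eigenvalueNear, map_multiset_sum]
  simp only [Function.comp_def, Complex.dist_conj_conj]

lemma eigenvalueNear_im_eq_zero (T : Matrix n n ℝ) (b r : ℝ) :
    (eigenvalueNear (T.map Complex.ofReal) b r).im = 0 := by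
  have hconj := eigenvalueNear_map_conj (T.map Complex.ofReal) b r
  rw [Complex.conj_ofReal, Matrix.map_map] at hconj
  refine Complex.conj_eq_iff_im.1 (Eq.trans hconj.symm ?_)
  congr 1
  ext i j
  simp

/-- `b` is a simple eigenvalue of `M` at distance at least `d` from all other eigenvalues. -/
structure IsIsolatedEigenvalue (M : Matrix n n ℂ) (b : ℂ) (d : ℝ) : Prop where
  isSimpleEigenvalue : IsSimpleEigenvalue M b
  le_norm_sub : ∀ y ∈ spectrum ℂ M, y ≠ b → d ≤ ‖y - b‖

namespace IsIsolatedEigenvalue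

open Metric
open scoped Matrix.Norms.L2Operator

variable [IsStarNormal M]

lemma norm_sub_le (h : IsIsolatedEigenvalue M b d) (hx : x ∈ spectrum ℂ T)
    (hxb : ‖x - b‖ ≤ d / 2) : ‖x - b‖ ≤ ‖T - M‖ := by
  obtain ⟨y, hy, hxy⟩ := exists_mem_spectrum_norm_sub_le (a := M) (c := T - M)
    (by rwa [add_sub_cancel])
  by_cases hyb : y = b
  · rwa [← hyb]
  · have htriangle := norm_sub_le_norm_sub_add_norm_sub y x b
    rw [norm_sub_rev y x] at htriangle
    linarith [h.le_norm_sub y hy hyb]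

lemma card_filter_roots (h : IsIsolatedEigenvalue M b d) (hT : ‖T - M‖ < d / 2) :
    Multiset.card (T.charpoly.roots.filter (dist · b < d / 2)) = 1 := by
  have hd : 0 < d / 2 := (norm_nonneg _).trans_lt hT
  have hball : IsPreconnected (ball M (d / 2)) := (convex_ball M (d / 2)).isPreconnected
  have : PreconnectedSpace (ball M (d / 2)) := Subtype.preconnectedSpace hball
  have hsphere (D : ball M (d / 2)) (w : ℂ) (hw : w ∈ sphere b (d / 2)) :
      (D : Matrix n n ℂ).charpoly.eval w ≠ 0 := fun h0 => by
    have hDM : ‖(D : Matrix n n ℂ) - M‖ < d / 2 := mem_ball_iff_norm.1 D.2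
    rw [mem_sphere_iff_norm] at hw
    linarith [h.norm_sub_le (Matrix.mem_spectrum_iff_isRoot_charpoly.2 h0) hw.le]
  have hconst := countP_roots_eq_of_preconnectedSpace
    (p := fun D : ball M (d / 2) => (D : Matrix n n ℂ).charpoly)
    (fun D => (D : Matrix n n ℂ).charpoly_natDegree_eq_dim.le)
    (fun k => (continuous_coeff_charpoly k).comp continuous_subtype_val) hd.le hsphere
    ⟨T, mem_ball_iff_norm.2 hT⟩ ⟨M, mem_ball_self hd⟩
  have hM : M.charpoly.roots.countP (dist · b < d / 2) = M.charpoly.roots.count b := by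
    refine Multiset.countP_congr rfl fun y hy => ?_
    rw [eq_iff_iff, eq_comm]
    refine ⟨fun hyb => ?_, fun hyb => by rwa [← hyb, dist_self]⟩
    by_contra hne
    have := h.le_norm_sub y (mem_roots_charpoly.1 hy) hne
    rw [dist_eq_norm] at hyb
    linarith
  rw [← Multiset.countP_eq_card_filter, hconst, hM,
    isSimpleEigenvalue_iff_count.1 h.isSimpleEigenvalue]

lemma filter_roots_eq_singleton (h : IsIsolatedEigenvalue M b d) (hT : ‖T - M‖ < d / 2) :
    T.charpoly.roots.filter (dist · b < d / 2) = {eigenvalueNear T b (d / 2)} := by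
  obtain ⟨y, hy⟩ := Multiset.card_eq_one.1 (h.card_filter_roots hT)
  rw [eigenvalueNear, hy, Multiset.sum_singleton]

lemma eq_eigenvalueNear_iff (h : IsIsolatedEigenvalue M b d) (hT : ‖T - M‖ < d / 2) :
    x = eigenvalueNear T b (d / 2) ↔ x ∈ T.charpoly.roots ∧ dist x b < d / 2 := by
  rw [← Multiset.mem_filter (p := (dist · b < d / 2)), h.filter_roots_eq_singleton hT,
    Multiset.mem_singleton]

lemma isSimpleEigenvalue_eigenvalueNear (h : IsIsolatedEigenvalue M b d) (hT : ‖T - M‖ < d / 2) :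
    IsSimpleEigenvalue T (eigenvalueNear T b (d / 2)) := by
  rw [isSimpleEigenvalue_iff_count, ← Multiset.count_filter_of_pos (p := (dist · b < d / 2))
    ((h.eq_eigenvalueNear_iff hT).1 rfl).2, h.filter_roots_eq_singleton hT,
    Multiset.count_singleton_self]

lemma norm_eigenvalueNear_sub_le (h : IsIsolatedEigenvalue M b d) (hT : ‖T - M‖ < d / 2) :
    ‖eigenvalueNear T b (d / 2) - b‖ ≤ ‖T - M‖ := by
  obtain ⟨hroot, hdist⟩ := (h.eq_eigenvalueNear_iff hT).1 rfl
  rw [dist_eq_norm] at hdist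
  exact h.norm_sub_le (mem_roots_charpoly.1 hroot) hdist.le

lemma analyticAt_eigenvalueNear (h : IsIsolatedEigenvalue M b d) (hT : ‖T - M‖ < d / 2) :
    AnalyticAt ℂ (fun T => eigenvalueNear T b (d / 2)) T := by
  have hroot (x : ℂ) : x ∈ T.charpoly.roots → T.charpoly.eval x = 0 :=
    Polynomial.isRoot_of_mem_roots
  refine analyticAt_of_eventually_unique (f := fun q => q.1.charpoly.eval q.2)
    (V := ball b (d / 2)) (analyticAt_eval_charpoly analyticAt_fst analyticAt_snd) ?_
    (isOpen_ball.mem_nhds ((h.eq_eigenvalueNear_iff hT).1 rfl).2) ?_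
  · simp only [Polynomial.deriv]
    exact (h.isSimpleEigenvalue_eigenvalueNear hT).derivative_ne_zero
  · filter_upwards [isOpen_ball.mem_nhds (mem_ball_iff_norm.2 hT)] with D hD x hx hDx
    refine (h.eq_eigenvalueNear_iff (mem_ball_iff_norm.1 hD)).2 ⟨?_, hx⟩
    rw [Polynomial.mem_roots D.charpoly_monic.ne_zero, Polynomial.IsRoot, hDx]
    exact hroot _ ((h.eq_eigenvalueNear_iff hT).1 rfl).1

variable {ι : Type*} {b : ι → ℂ}

lemma injective_eigenvalueNear (h : ∀ i, IsIsolatedEigenvalue M (b i) d) (hb : b.Injective)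
    (hT : ‖T - M‖ < d / 2) : Function.Injective fun i => eigenvalueNear T (b i) (d / 2) := by
  intro i j hij
  by_contra hne
  have hi := (h i).norm_eigenvalueNear_sub_le hT
  have hj := (h j).norm_eigenvalueNear_sub_le hT
  have hgap := (h j).le_norm_sub (b i) (Matrix.mem_spectrum_iff_isRoot_charpoly.2
    (h i).isSimpleEigenvalue.isRoot) (hb.ne hne)
  simp only at hij
  rw [← hij] at hj
  rw [norm_sub_rev] at hi
  linarith [norm_sub_le_norm_sub_add_norm_sub (b i) (eigenvalueNear T (b i) (d / 2)) (b j)]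

lemma filter_roots_eq_map [Fintype ι] [DecidablePred fun x => ∃ i, dist x (b i) < d / 2]
    (h : ∀ i, IsIsolatedEigenvalue M (b i) d) (hb : b.Injective) (hT : ‖T - M‖ < d / 2) :
    T.charpoly.roots.filter (fun x => ∃ i, dist x (b i) < d / 2)
      = Finset.univ.val.map fun i => eigenvalueNear T (b i) (d / 2) := by
  have hmem (x : ℂ) : x ∈ T.charpoly.roots.filter (fun x => ∃ i, dist x (b i) < d / 2) ↔
      ∃ i, eigenvalueNear T (b i) (d / 2) = x := by
    simp only [Multiset.mem_filter, ← exists_and_left, ← (h _).eq_eigenvalueNear_iff hT, eq_comm]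
  refine (Multiset.Nodup.ext ?_ ?_).2 fun x => ?_
  · refine Multiset.nodup_iff_count_eq_one.2 fun x hx => ?_
    obtain ⟨i, rfl⟩ := (hmem x).1 hx
    rw [Multiset.count_filter_of_pos (Multiset.of_mem_filter hx)]
    exact isSimpleEigenvalue_iff_count.1 ((h i).isSimpleEigenvalue_eigenvalueNear hT)
  · exact Finset.univ.nodup.map (injective_eigenvalueNear h hb hT)
  · simp only [hmem, Multiset.mem_map, Finset.mem_val, Finset.mem_univ, true_and]

end IsIsolatedEigenvalue

end IsolatedEigenvalues

section MatrixSpectra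

open scoped Matrix.Norms.L2Operator

lemma neg_mem_spectrum_of_transpose_eq_neg {n : Type*} [Fintype n] [DecidableEq n]
    {M : Matrix n n ℂ} (hM : Mᵀ = -M) {x : ℂ} (hx : x ∈ spectrum ℂ M) : -x ∈ spectrum ℂ M := by
  rw [← Set.mem_neg, spectrum.neg_eq, ← hM, Matrix.mem_spectrum_iff_isRoot_charpoly,
    Matrix.charpoly_transpose]
  exact Matrix.mem_spectrum_iff_isRoot_charpoly.1 hx

lemma isGreatest_norm_of_transpose_eq_neg {n : Type*} [Fintype n] [DecidableEq n] [Nonempty n]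
    {M : Matrix n n ℂ} (hM : M.IsHermitian) (hskew : Mᵀ = -M) :
    IsGreatest {ω : ℝ | (ω : ℂ) ∈ spectrum ℂ M} ‖M‖ := by
  have hself : IsSelfAdjoint M := hM
  constructor
  · obtain ⟨x, hx, hnorm⟩ := spectrum.exists_nnnorm_eq_spectralRadius M
    rw [hself.spectralRadius_eq_nnnorm, ENNReal.coe_inj] at hnorm
    have hxM : ‖x‖ = ‖M‖ := congrArg NNReal.toReal hnorm
    have hre : x = (x.re : ℂ) := hself.mem_spectrum_eq_re hx
    rw [hre, Complex.norm_real, Real.norm_eq_abs] at hxM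
    rw [hre] at hx
    rcases abs_choice x.re with h | h
    · rwa [Set.mem_ofPred_eq, ← hxM, h]
    · rw [Set.mem_ofPred_eq, ← hxM, h, Complex.ofReal_neg]
      exact neg_mem_spectrum_of_transpose_eq_neg hskew hx
  · exact fun ω hω => (Real.le_norm_self ω).trans ((Complex.norm_real ω).symm.trans_le
      (spectrum.norm_le_norm_of_mem hω))

/-- Because `x = b⁻¹ (f x - (f - b) x)`, and a lower power of `f - b` annihilates `(f - b) x`. -/
lemma maxGenEigenspace_le_range {K V : Type*} [Field K] [AddCommGroup V] [Module K V]
    (f : Module.End K V) {b : K} (hb : b ≠ 0) :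
    f.maxGenEigenspace b ≤ LinearMap.range f := by
  intro x hx
  obtain ⟨k, hk⟩ := Module.End.mem_maxGenEigenspace _ _ _ |>.1 hx
  clear hx
  induction k generalizing x with
  | zero => rw [pow_zero, Module.End.one_apply] at hk; exact hk ▸ zero_mem _
  | succ k ih =>
    rw [pow_succ, Module.End.mul_apply] at hk
    have hxb : b • x = f x - (f - b • (1 : Module.End K V)) x := by simp
    rw [← inv_smul_smul₀ hb x, hxb]
    exact Submodule.smul_mem _ _ (sub_mem (LinearMap.mem_range_self f x) (ih hk))

lemma rootMultiplicity_charpoly_restrict_range {K V : Type*} [Field K] [AddCommGroup V]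
    [Module K V] [FiniteDimensional K V] (f : Module.End K V) {b : K} (hb : b ≠ 0) :
    (f.restrict fun x (_ : x ∈ LinearMap.range f) =>
      LinearMap.mem_range_self f x).charpoly.rootMultiplicity b
        = f.charpoly.rootMultiplicity b := by
  rw [← LinearMap.finrank_maxGenEigenspace_eq, ← LinearMap.finrank_maxGenEigenspace_eq,
    Module.End.maxGenEigenspace, Module.End.genEigenspace_restrict]
  exact (Submodule.comapSubtypeEquivOfLe (maxGenEigenspace_le_range f hb)).finrank_eq

end MatrixSpectra

section RealSquareRoot

variable {n : Type*} [Fintype n] [DecidableEq n] {X : Matrix n n ℝ}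

lemma transpose_sqrt (X : Matrix n n ℝ) : (CFC.sqrt X)ᵀ = CFC.sqrt X := by
  have h := (Matrix.nonneg_iff_posSemidef.1 (CFC.sqrt_nonneg X)).isHermitian
  rwa [Matrix.isHermitian_iff_isSymm] at h

lemma isUnit_det_sqrt (hX : X.PosDef) : IsUnit (CFC.sqrt X).det := by
  have h : CFC.sqrt X * CFC.sqrt X = X :=
    CFC.sqrt_mul_sqrt_self X (Matrix.nonneg_iff_posSemidef.2 hX.posSemidef)
  refine isUnit_of_mul_isUnit_left (y := (CFC.sqrt X).det) ?_
  rw [← Matrix.det_mul, h]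
  exact hX.det_pos.ne'.isUnit

end RealSquareRoot

namespace LagrangianSystem

open Metric
open scoped Matrix.Norms.L2Operator

variable {N : ℕ} (S : LagrangianSystem N)

lemma pos_dim (S : LagrangianSystem N) : 0 < N :=
  S.R_rank_pos.trans_le <| (Matrix.rank_le_card_width S.R).trans_eq (Fintype.card_fin N)

lemma nonempty_index (S : LagrangianSystem N) : Nonempty (Fin N) := ⟨⟨0, S.pos_dim⟩⟩

lemma transpose_Kp : S.Kpᵀ = S.Kp := by
  rw [Kp, Matrix.transpose_nonsing_inv, transpose_sqrt]

lemma isUnit_det_Kp : IsUnit S.Kp.det := by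
  rw [Kp, Matrix.det_nonsing_inv]
  exact (isUnit_det_sqrt S.α_pos).ringInverse

/-! ### The frequency operator -/

/-- The real antisymmetric matrix `i Ω`. -/
def realOmega : Matrix (Fin N ⊕ Fin N) (Fin N ⊕ Fin N) ℝ :=
  Matrix.fromBlocks ((2 : ℝ) • (S.Kp * S.θ * S.Kpᵀ)) S.Phiᵀ (-S.Phi) 0

lemma I_smul_Omega : Complex.I • S.Omega = S.realOmega.map Complex.ofReal := by
  rw [Omega, realOmega, Matrix.fromBlocks_smul, Matrix.fromBlocks_map]
  congr 1 <;> ext i j <;> simp [← mul_assoc, mul_comm (2 : ℂ) Complex.I]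

lemma transpose_realOmega : S.realOmegaᵀ = -S.realOmega := by
  rw [realOmega, Matrix.fromBlocks_transpose, Matrix.fromBlocks_neg]
  simp only [Matrix.transpose_smul, Matrix.transpose_mul, Matrix.transpose_transpose, S.θ_skew,
    Matrix.transpose_neg, Matrix.transpose_zero, neg_neg, neg_zero, Matrix.mul_neg, Matrix.neg_mul,
    smul_neg, Matrix.mul_assoc]

lemma Omega_eq_smul_realOmega : S.Omega = (-Complex.I) • S.realOmega.map Complex.ofReal := by
  rw [← I_smul_Omega, smul_smul, neg_mul, Complex.I_mul_I, neg_neg, one_smul]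

lemma transpose_Omega : S.Omegaᵀ = -S.Omega := by
  rw [Omega_eq_smul_realOmega, Matrix.transpose_smul, ← Matrix.transpose_map, transpose_realOmega]
  ext i j
  simp

lemma isHermitian_Omega : S.Omega.IsHermitian := by
  ext i j
  have h : S.realOmega j i = -S.realOmega i j := congrFun (congrFun S.transpose_realOmega i) j
  simp [Omega_eq_smul_realOmega, h]

lemma norm_Omega : ‖S.Omega‖ = S.omegaMax :=
  have := S.nonempty_index
  (isGreatest_norm_of_transpose_eq_neg S.isHermitian_Omega S.transpose_Omega).csSup_eq.symm

/-! ### The loss eigenvalues -/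

lemma isHermitian_Kp_mul_R_mul : (S.Kp * S.R * S.Kpᵀ).IsHermitian := by
  simpa only [Matrix.conjTranspose_eq_transpose_of_trivial] using
    Matrix.isHermitian_mul_mul_conjTranspose S.Kp S.R_nonneg.isHermitian

lemma isHermitian_B : S.B.IsHermitian :=
  Matrix.IsHermitian.fromBlocks
    (S.isHermitian_Kp_mul_R_mul.map _ fun x => (Complex.conj_ofReal x).symm)
    Matrix.conjTranspose_zero Matrix.isHermitian_zero

instance : IsStarNormal S.B := S.isHermitian_B.isSelfAdjoint.isStarNormal

lemma charpoly_B : S.B.charpoly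
    = (S.Kp * S.R * S.Kpᵀ).charpoly.map Complex.ofRealHom * Polynomial.X ^ N := by
  rw [B, Matrix.charpoly_fromBlocks_zero₁₂, Matrix.charpoly_zero, Fintype.card_fin]
  exact congrArg (· * _) (Matrix.charpoly_map _ Complex.ofRealHom)

lemma zero_mem_spectrum_B : (0 : ℂ) ∈ spectrum ℂ S.B := by
  rw [Matrix.mem_spectrum_iff_isRoot_charpoly, charpoly_B, Polynomial.IsRoot, Polynomial.eval_mul,
    Polynomial.eval_pow, Polynomial.eval_X, zero_pow S.pos_dim.ne', mul_zero]

lemma rank_Kp_mul_R_mul : (S.Kp * S.R * S.Kpᵀ).rank = S.rankR := by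
  rw [Matrix.rank_mul_eq_left_of_isUnit_det _ _ (Matrix.isUnit_det_transpose _ S.isUnit_det_Kp),
    Matrix.rank_mul_eq_right_of_isUnit_det _ _ S.isUnit_det_Kp, rankR]

/-- The nonzero eigenvalues `b₁, …, b_{N_R}` of `B`, repeated according to multiplicity. -/
def lossEigenvalue (j : Fin S.rankR) : ℝ :=
  S.isHermitian_Kp_mul_R_mul.eigenvalues
    ((Fintype.equivFinOfCardEq <| S.isHermitian_Kp_mul_R_mul.rank_eq_card_non_zero_eigs.symm.trans
      S.rank_Kp_mul_R_mul).symm j)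

lemma map_lossEigenvalue : Finset.univ.val.map S.lossEigenvalue
    = (S.Kp * S.R * S.Kpᵀ).charpoly.roots.filter (· ≠ 0) := by
  set e := Fintype.equivFinOfCardEq <|
    S.isHermitian_Kp_mul_R_mul.rank_eq_card_non_zero_eigs.symm.trans S.rank_Kp_mul_R_mul with he
  have hcomp : S.lossEigenvalue ∘ e = S.isHermitian_Kp_mul_R_mul.eigenvalues ∘ Subtype.val := by
    ext k
    rw [Function.comp_apply, lossEigenvalue, ← he, e.symm_apply_apply, Function.comp_apply]
  rw [← Multiset.map_univ_val_equiv e, Multiset.map_map, hcomp, ← Multiset.map_map,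
    Finset.univ_val_map_subtype_val, Finset.filter_val,
    S.isHermitian_Kp_mul_R_mul.roots_charpoly_eq_eigenvalues, Multiset.filter_map]
  rfl

lemma filter_roots_charpoly_B : S.B.charpoly.roots.filter (· ≠ 0)
    = Finset.univ.val.map fun j => (S.lossEigenvalue j : ℂ) := by
  have hmap : Finset.univ.val.map (fun j => (S.lossEigenvalue j : ℂ))
      = (Finset.univ.val.map S.lossEigenvalue).map Complex.ofReal := by
    rw [Multiset.map_map]
    rfl
  have hroots : S.B.charpoly.roots
      = (S.Kp * S.R * S.Kpᵀ).charpoly.roots.map Complex.ofReal + N • {0} := by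
    rw [charpoly_B, Polynomial.roots_mul (charpoly_B S ▸ S.B.charpoly_monic.ne_zero),
      Polynomial.roots_X_pow, S.isHermitian_Kp_mul_R_mul.splits_charpoly.roots_map]
    rfl
  rw [hroots, hmap, map_lossEigenvalue, Multiset.filter_add, Multiset.filter_map,
    Multiset.filter_eq_nil (s := N • {(0 : ℂ)}).2 fun x hx =>
      not_not.2 (Multiset.mem_singleton.1 (Multiset.mem_of_mem_nsmul hx)), add_zero]
  simp only [Function.comp_def, Ne, Complex.ofReal_eq_zero]

lemma mem_spectrum_B_iff {b : ℂ} :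
    b ∈ spectrum ℂ S.B ↔ b = 0 ∨ ∃ j, (S.lossEigenvalue j : ℂ) = b := by
  have h := congrArg (b ∈ ·) S.filter_roots_charpoly_B
  simp only [Multiset.mem_filter, mem_roots_charpoly, Multiset.mem_map, Finset.mem_val,
    Finset.mem_univ, true_and, eq_iff_iff] at h
  rw [← h]
  by_cases hb : b = 0
  · simp only [hb, S.zero_mem_spectrum_B, true_or]
  · simp only [hb, false_or, ne_eq, not_false_eq_true, and_true]

lemma lossEigenvalue_ne_zero (j : Fin S.rankR) : (S.lossEigenvalue j : ℂ) ≠ 0 := by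
  have h : (S.lossEigenvalue j : ℂ) ∈ S.B.charpoly.roots.filter (· ≠ 0) := by
    rw [filter_roots_charpoly_B]
    exact Multiset.mem_map_of_mem _ (Finset.mem_univ j)
  exact (Multiset.mem_filter.1 h).2

lemma lossEigenvalue_mem_spectrum (j : Fin S.rankR) :
    (S.lossEigenvalue j : ℂ) ∈ spectrum ℂ S.B :=
  S.mem_spectrum_B_iff.2 (Or.inr ⟨j, rfl⟩)

lemma gap_le {b b' : ℂ} (hb : b ∈ spectrum ℂ S.B) (hb' : b' ∈ spectrum ℂ S.B) (h : b ≠ b') :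
    S.gap ≤ ‖b - b'‖ := by
  refine csInf_le ⟨0, ?_⟩ ⟨b, hb, b', hb', h, rfl⟩
  rintro _ ⟨_, _, _, _, _, rfl⟩
  exact norm_nonneg _

lemma gap_le_norm_lossEigenvalue (j : Fin S.rankR) : S.gap ≤ ‖(S.lossEigenvalue j : ℂ)‖ := by
  simpa only [sub_zero] using S.gap_le (S.lossEigenvalue_mem_spectrum j) S.zero_mem_spectrum_B
    (S.lossEigenvalue_ne_zero j)

lemma gap_pos : 0 < S.gap := by
  have hfinite : (Set.image (fun p : ℂ × ℂ => ‖p.1 - p.2‖)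
      (spectrum ℂ S.B ×ˢ spectrum ℂ S.B)).Finite :=
    ((Matrix.finite_spectrum S.B).prod (Matrix.finite_spectrum S.B)).image _
  obtain ⟨b, _, b', _, hne, hgap⟩ := Set.Nonempty.csInf_mem
    (s := {x : ℝ | ∃ b ∈ spectrum ℂ S.B, ∃ b' ∈ spectrum ℂ S.B, b ≠ b' ∧ x = ‖b - b'‖})
    ⟨_, _, S.lossEigenvalue_mem_spectrum ⟨0, S.R_rank_pos⟩, 0, S.zero_mem_spectrum_B,
      S.lossEigenvalue_ne_zero _, rfl⟩
    (hfinite.subset fun x ⟨b, hb, b', hb', _, hx⟩ => ⟨(b, b'), ⟨hb, hb'⟩, hx.symm⟩)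
  rw [gap, hgap]
  exact norm_pos_iff.2 (sub_ne_zero.2 hne)

variable {S}

lemma Generic.nodup_filter_roots_charpoly_B (hgen : S.Generic) :
    (S.B.charpoly.roots.filter (· ≠ 0)).Nodup := by
  refine Multiset.nodup_iff_count_le_one.2 fun b => ?_
  by_cases hb : b = 0
  · rw [Multiset.count_eq_zero_of_notMem fun h =>
      (Multiset.mem_filter (p := (· ≠ 0)).1 h).2 hb]
    exact zero_le_one
  · rw [Multiset.count_filter_of_pos (p := (· ≠ 0)) hb, Polynomial.count_roots,
      ← Matrix.charpoly_toLin', ← rootMultiplicity_charpoly_restrict_range _ hb,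
      ← Polynomial.count_roots]
    exact Multiset.nodup_iff_count_le_one.1 hgen b

lemma Generic.injective_lossEigenvalue (hgen : S.Generic) :
    Function.Injective fun j => (S.lossEigenvalue j : ℂ) := fun i j hij =>
  Multiset.inj_on_of_nodup_map (S.filter_roots_charpoly_B ▸ hgen.nodup_filter_roots_charpoly_B)
    i (Finset.mem_univ i) j (Finset.mem_univ j) hij

lemma Generic.isIsolatedEigenvalue (hgen : S.Generic) (j : Fin S.rankR) :
    IsIsolatedEigenvalue S.B (S.lossEigenvalue j) S.gap where
  isSimpleEigenvalue := by
    rw [isSimpleEigenvalue_iff_count,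
      ← Multiset.count_filter_of_pos (p := (· ≠ 0)) (S.lossEigenvalue_ne_zero j)]
    refine Multiset.count_eq_one_of_mem hgen.nodup_filter_roots_charpoly_B ?_
    exact Multiset.mem_filter.2 ⟨mem_roots_charpoly.2 (S.lossEigenvalue_mem_spectrum j),
      S.lossEigenvalue_ne_zero j⟩
  le_norm_sub _ hy := S.gap_le hy (S.lossEigenvalue_mem_spectrum j)

variable (S)

/-! ### The pencil -/

/-- The pencil `B + z i Ω = i z A(z⁻¹)`. Unlike `A(z⁻¹)` it is analytic at `z = 0`, and it is a
real matrix for real `z`. -/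
def pencil (z : ℂ) : Matrix (Fin N ⊕ Fin N) (Fin N ⊕ Fin N) ℂ :=
  S.B + z • (Complex.I • S.Omega)

variable {z : ℂ}

lemma A_inv_eq_smul_pencil (hz : z ≠ 0) : S.A z⁻¹ = (-Complex.I * z⁻¹) • S.pencil z := by
  have hcancel : -Complex.I * z⁻¹ * z * Complex.I = 1 := by
    field_simp
    linear_combination -Complex.I_mul_I
  rw [A, pencil, smul_add, smul_smul, smul_smul, hcancel]
  module

lemma pencil_ofReal (t : ℝ) : ∃ T : Matrix (Fin N ⊕ Fin N) (Fin N ⊕ Fin N) ℝ,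
    S.pencil t = T.map Complex.ofReal := by
  refine ⟨Matrix.fromBlocks (S.Kp * S.R * S.Kpᵀ) 0 0 0 + t • S.realOmega, ?_⟩
  rw [pencil, I_smul_Omega, B, Matrix.map_add _ Complex.ofReal_add, Matrix.fromBlocks_map]
  congr 1
  ext i j
  simp

lemma analyticAt_pencil : AnalyticAt ℂ S.pencil z :=
  analyticAt_const.add (analyticAt_id.smul analyticAt_const)

lemma norm_pencil_sub_B (z : ℂ) : ‖S.pencil z - S.B‖ = ‖z‖ * S.omegaMax := by
  rw [pencil, add_sub_cancel_left, norm_smul, norm_smul, Complex.norm_I, one_mul, norm_Omega]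

lemma norm_pencil_sub_B_lt (hz : ‖z‖ * S.beta0 < 1) : ‖S.pencil z - S.B‖ < S.gap / 2 := by
  rw [beta0, mul_div_assoc', div_lt_one S.gap_pos] at hz
  rw [norm_pencil_sub_B]
  linarith

/-- The eigenvalue of the pencil that equals `b_j` at `z = 0`. -/
def pencilEigenvalue (j : Fin S.rankR) (z : ℂ) : ℂ :=
  eigenvalueNear (S.pencil z) (S.lossEigenvalue j) (S.gap / 2)

lemma pencilEigenvalue_im (j : Fin S.rankR) (t : ℝ) : (S.pencilEigenvalue j t).im = 0 := by
  obtain ⟨T, hT⟩ := S.pencil_ofReal t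
  rw [pencilEigenvalue, hT, eigenvalueNear_im_eq_zero]

variable {S} (hgen : S.Generic) (hz : ‖z‖ * S.beta0 < 1)
include hgen hz

lemma Generic.isSimpleEigenvalue_pencil (j : Fin S.rankR) :
    IsSimpleEigenvalue (S.pencil z) (S.pencilEigenvalue j z) :=
  (hgen.isIsolatedEigenvalue j).isSimpleEigenvalue_eigenvalueNear (S.norm_pencil_sub_B_lt hz)

lemma Generic.analyticAt_pencilEigenvalue (j : Fin S.rankR) :
    AnalyticAt ℂ (S.pencilEigenvalue j) z :=
  ((hgen.isIsolatedEigenvalue j).analyticAt_eigenvalueNear (S.norm_pencil_sub_B_lt hz)).comp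
    S.analyticAt_pencil

lemma Generic.gap_div_two_lt_norm_pencilEigenvalue (j : Fin S.rankR) :
    S.gap / 2 < ‖S.pencilEigenvalue j z‖ := by
  have hlt := S.norm_pencil_sub_B_lt hz
  have hnear : ‖S.pencilEigenvalue j z - S.lossEigenvalue j‖ ≤ ‖S.pencil z - S.B‖ :=
    (hgen.isIsolatedEigenvalue j).norm_eigenvalueNear_sub_le hlt
  rw [norm_sub_rev] at hnear
  linarith [S.gap_le_norm_lossEigenvalue j,
    norm_sub_norm_le (S.lossEigenvalue j : ℂ) (S.pencilEigenvalue j z)]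

/-- Bauer–Fike: the remaining eigenvalues of the pencil are within `|z| ω_max` of `b₀ = 0`. -/
lemma Generic.filter_roots_pencil :
    (S.pencil z).charpoly.roots.filter (‖z‖ * S.omegaMax < ‖·‖)
      = Finset.univ.val.map (S.pencilEigenvalue · z) := by
  have hlt := S.norm_pencil_sub_B_lt hz
  refine Eq.trans (Multiset.filter_congr fun x hx => ?_)
    (IsIsolatedEigenvalue.filter_roots_eq_map hgen.isIsolatedEigenvalue
      hgen.injective_lossEigenvalue hlt)
  rw [← norm_pencil_sub_B]
  constructor
  · intro hxlt
    obtain ⟨b, hb, hxb⟩ := exists_mem_spectrum_norm_sub_le (a := S.B) (c := S.pencil z - S.B)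
      (by rw [add_sub_cancel]; exact mem_roots_charpoly.1 hx)
    rcases S.mem_spectrum_B_iff.1 hb with rfl | ⟨j, rfl⟩
    · rw [sub_zero] at hxb
      exact absurd hxb hxlt.not_ge
    · exact ⟨j, (dist_eq_norm _ _).trans_lt (hxb.trans_lt hlt)⟩
  · rintro ⟨j, hj⟩
    rw [dist_eq_norm, norm_sub_rev] at hj
    linarith [S.gap_le_norm_lossEigenvalue j, norm_sub_norm_le (S.lossEigenvalue j : ℂ) x]

omit hgen hz

lemma beta0_nonneg (S : LagrangianSystem N) : 0 ≤ S.beta0 :=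
  div_nonneg (mul_nonneg two_pos.le (S.norm_Omega ▸ norm_nonneg _)) S.gap_pos.le

lemma norm_mul_beta0_lt_one_of_mem_ball {r : ℝ} (hr : S.beta0 ≤ r) (hz : z ∈ ball 0 r⁻¹) :
    ‖z‖ * S.beta0 < 1 := by
  rw [mem_ball_zero_iff] at hz
  have hr0 : 0 < r := inv_pos.1 ((norm_nonneg z).trans_lt hz)
  calc ‖z‖ * S.beta0 ≤ ‖z‖ * r := mul_le_mul_of_nonneg_left hr (norm_nonneg z)
    _ < r⁻¹ * r := mul_lt_mul_of_pos_right hz hr0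
    _ = 1 := inv_mul_cancel₀ hr0.ne'

variable {β : ℝ}

lemma norm_inv_mul_beta0_lt_one (hβ : S.beta0 < β) : ‖(β : ℂ)⁻¹‖ * S.beta0 < 1 := by
  have hβ0 : 0 < β := S.beta0_nonneg.trans_lt hβ
  rwa [norm_inv, Complex.norm_of_nonneg hβ0.le, inv_mul_lt_iff₀ hβ0, mul_one]

lemma inv_ofReal_ne_zero (hβ : S.beta0 < β) : (β : ℂ)⁻¹ ≠ 0 :=
  inv_ne_zero (Complex.ofReal_ne_zero.2 (S.beta0_nonneg.trans_lt hβ).ne')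

variable (S)

/-! ### High-loss eigenvalues -/

/-- The high-loss eigenvalue `ζ_j` of `A(β)` as a function of `z = β⁻¹`. -/
def highLossEigenvalue (j : Fin S.rankR) (z : ℂ) : ℂ :=
  -Complex.I * z⁻¹ * S.pencilEigenvalue j z

/-- The eigenprojection of `A(z⁻¹)` for the high-loss eigenvalue `ζ_j`. Taken from the pencil, it
is meaningful at `z = 0` too. -/
def highLossProjection (j : Fin S.rankR) (z : ℂ) : Matrix (Fin N ⊕ Fin N) (Fin N ⊕ Fin N) ℂ :=
  eigenprojection (S.pencil z) (S.pencilEigenvalue j z)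

lemma isSpectralImage_pencil_A (hz : z ≠ 0) :
    IsSpectralImage (-Complex.I * z⁻¹ * ·) (S.pencil z) (S.A z⁻¹) :=
  S.A_inv_eq_smul_pencil hz ▸
    isSpectralImage_smul (mul_ne_zero (neg_ne_zero.2 Complex.I_ne_zero) (inv_ne_zero hz)) _

lemma highLossEigenvalue_re (j : Fin S.rankR) (β : ℝ) :
    (S.highLossEigenvalue j (β : ℂ)⁻¹).re = 0 := by
  have him : (S.pencilEigenvalue j (β : ℂ)⁻¹).im = 0 :=
    Complex.ofReal_inv β ▸ S.pencilEigenvalue_im j β⁻¹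
  simp [highLossEigenvalue, him]

variable {S}

lemma Generic.analyticAt_highLossEigenvalue (hgen : S.Generic) (hz : ‖z‖ * S.beta0 < 1)
    (hz0 : z ≠ 0) (j : Fin S.rankR) : AnalyticAt ℂ (S.highLossEigenvalue j) z :=
  (analyticAt_const.mul (analyticAt_inv hz0)).mul (hgen.analyticAt_pencilEigenvalue hz j)

lemma Generic.meromorphicAt_highLossEigenvalue (hgen : S.Generic) (hz : ‖z‖ * S.beta0 < 1)
    (j : Fin S.rankR) : MeromorphicAt (S.highLossEigenvalue j) z :=
  ((MeromorphicAt.const _ z).mul (MeromorphicAt.id z).inv).mul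
    (hgen.analyticAt_pencilEigenvalue hz j).meromorphicAt

lemma Generic.analyticAt_highLossProjection (hgen : S.Generic) (hz : ‖z‖ * S.beta0 < 1)
    (j : Fin S.rankR) : AnalyticAt ℂ (S.highLossProjection j) z :=
  analyticAt_eigenprojection S.analyticAt_pencil (hgen.analyticAt_pencilEigenvalue hz j)
    (hgen.isSimpleEigenvalue_pencil hz j)

lemma Generic.rank_highLossProjection (hgen : S.Generic) (hz : ‖z‖ * S.beta0 < 1)
    (j : Fin S.rankR) : (S.highLossProjection j z).rank = 1 :=
  (hgen.isSimpleEigenvalue_pencil hz j).isSimpleEigenprojection.rank_eq_one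

lemma Generic.isSimpleEigenprojection_highLoss (hgen : S.Generic) (hz : ‖z‖ * S.beta0 < 1)
    (hz0 : z ≠ 0) (j : Fin S.rankR) :
    IsSimpleEigenprojection (S.A z⁻¹) (S.highLossEigenvalue j z) (S.highLossProjection j z) :=
  (S.isSpectralImage_pencil_A hz0).isSimpleEigenprojection
    (hgen.isSimpleEigenvalue_pencil hz j).isSimpleEigenprojection

lemma Generic.filter_roots_A (hgen : S.Generic) (hz : ‖z‖ * S.beta0 < 1) (hz0 : z ≠ 0) :
    (S.A z⁻¹).charpoly.roots.filter (S.omegaMax < ‖·‖)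
      = Finset.univ.val.map (S.highLossEigenvalue · z) := by
  have hnorm (x : ℂ) : S.omegaMax < ‖-Complex.I * z⁻¹ * x‖ ↔ ‖z‖ * S.omegaMax < ‖x‖ := by
    rw [norm_mul, norm_mul, norm_neg, Complex.norm_I, one_mul, norm_inv,
      lt_inv_mul_iff₀ (norm_pos_iff.2 hz0)]
  rw [(S.isSpectralImage_pencil_A hz0).roots_charpoly, Multiset.filter_map]
  simp only [Function.comp_def, hnorm, hgen.filter_roots_pencil hz, Multiset.map_map]
  rfl

lemma Generic.gap_mul_le_norm_highLossEigenvalue (hgen : S.Generic) (hz : ‖z‖ * S.beta0 < 1)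
    (j : Fin S.rankR) : S.gap / 2 * ‖z⁻¹‖ ≤ ‖S.highLossEigenvalue j z‖ := by
  rw [highLossEigenvalue, norm_mul, norm_mul, norm_neg, Complex.norm_I, one_mul, mul_comm]
  gcongr
  exact (hgen.gap_div_two_lt_norm_pencilEigenvalue hz j).le

lemma Generic.isHighLossFamily (hgen : S.Generic) : S.IsHighLossFamily S.highLossEigenvalue := by
  refine ⟨fun j => ?_, S.omegaMax, ?_⟩
  · refine tendsto_atTop_mono' atTop ?_
      (Filter.tendsto_id.const_mul_atTop (half_pos S.gap_pos))
    filter_upwards [eventually_gt_atTop S.beta0] with β hβ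
    have hle := hgen.gap_mul_le_norm_highLossEigenvalue (norm_inv_mul_beta0_lt_one hβ) j
    rwa [inv_inv, Complex.norm_of_nonneg (S.beta0_nonneg.trans hβ.le)] at hle
  · filter_upwards [eventually_gt_atTop S.beta0] with β hβ
    have h := hgen.filter_roots_A (norm_inv_mul_beta0_lt_one hβ) (inv_ofReal_ne_zero hβ)
    rwa [inv_inv] at h

variable (S)

/-! ### Duality -/

/-- The matrix of a block operator after its two blocks have been interchanged. -/
def blockSwap {n : Type*} [Fintype n] [DecidableEq n] :
    Matrix (n ⊕ n) (n ⊕ n) ℂ ≃ₐ[ℂ] Matrix (n ⊕ n) (n ⊕ n) ℂ :=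
  Matrix.reindexAlgEquiv ℂ ℂ (Equiv.sumComm n n)

lemma blockSwap_fromBlocks {n : Type*} [Fintype n] [DecidableEq n] (X Y Z W : Matrix n n ℂ) :
    blockSwap (Matrix.fromBlocks X Y Z W) = Matrix.fromBlocks W Z Y X :=
  Matrix.fromBlocks_submatrix_sum_swap_sum_swap X Y Z W

lemma map_Kp_mul_mul (X : Matrix (Fin N) (Fin N) ℝ) : (S.Kp * X * S.Kpᵀ).map Complex.ofReal
    = S.Kp.map Complex.ofReal * X.map Complex.ofReal * S.Kp.map Complex.ofReal := by
  rw [transpose_Kp]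
  exact (Matrix.map_mul (f := Complex.ofRealHom)).trans
    (congrArg (· * _) (Matrix.map_mul (f := Complex.ofRealHom)))

/-- The coefficient `2θ + βR` of the velocity. -/
def damping (β : ℂ) : Matrix (Fin N) (Fin N) ℂ :=
  (2 : ℂ) • S.θ.map Complex.ofReal + β • S.R.map Complex.ofReal

lemma A_eq_fromBlocks (β : ℂ) : S.A β = Matrix.fromBlocks
    ((-Complex.I) • (S.Kp.map Complex.ofReal * S.damping β * S.Kp.map Complex.ofReal))
    ((-Complex.I) • S.Phiᵀ.map Complex.ofReal) (Complex.I • S.Phi.map Complex.ofReal) 0 := by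
  rw [A, Omega, B, map_Kp_mul_mul, map_Kp_mul_mul, sub_eq_add_neg, ← neg_smul,
    Matrix.fromBlocks_smul, Matrix.fromBlocks_add, damping, mul_add, add_mul]
  simp only [smul_zero, add_zero, mul_smul_comm, smul_mul_assoc]
  congr 1
  module

variable (hη : S.η.PosDef)

lemma Kp_dual_mul_Phi : (S.dual hη).Kp * S.Phi = S.Kp :=
  (Matrix.nonsing_inv_mul_cancel_left _ _ (isUnit_det_sqrt hη)).trans S.transpose_Kp

lemma Kp_mul_Phi_dual : S.Kp * (S.dual hη).Phi = (S.dual hη).Kp :=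
  (S.dual hη).Kp_dual_mul_Phi S.α_pos

lemma transpose_Phi_mul_Kp_dual : S.Phiᵀ * (S.dual hη).Kp = S.Kp := by
  rw [← (S.dual hη).transpose_Kp, ← Matrix.transpose_mul, Kp_dual_mul_Phi, transpose_Kp]

lemma Phi_dual_mul_Phi : (S.dual hη).Phi * S.Phi = 1 := by
  refine ((Matrix.isUnit_iff_isUnit_det _).2 S.isUnit_det_Kp).mul_left_cancel ?_
  rw [← mul_assoc, Kp_mul_Phi_dual, Kp_dual_mul_Phi, mul_one]

lemma A_mul_blockSwap_dual_A (β : ℂ) : S.A β * blockSwap ((S.dual hη).A β) = -1 := by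
  have hdamping : (S.dual hη).damping β = S.damping β := rfl
  have hmap {X Y Z : Matrix (Fin N) (Fin N) ℝ} (h : X * Y = Z) :
      X.map Complex.ofReal * Y.map Complex.ofReal = Z.map Complex.ofReal :=
    h ▸ (Matrix.map_mul (f := Complex.ofRealHom)).symm
  have hone : (1 : Matrix (Fin N) (Fin N) ℝ).map Complex.ofReal = 1 :=
    Matrix.map_one _ Complex.ofReal_zero Complex.ofReal_one
  have hΦ : S.Phi.map Complex.ofReal * (S.dual hη).Phi.map Complex.ofReal = 1 :=
    (hmap (mul_eq_one_comm.1 (S.Phi_dual_mul_Phi hη))).trans hone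
  have hΦT : S.Phiᵀ.map Complex.ofReal * (S.dual hη).Phiᵀ.map Complex.ofReal = 1 := by
    refine (hmap ?_).trans hone
    rw [← Matrix.transpose_mul, Phi_dual_mul_Phi, Matrix.transpose_one]
  rw [A_eq_fromBlocks, A_eq_fromBlocks, blockSwap_fromBlocks, Matrix.fromBlocks_multiply,
    hdamping, ← Matrix.fromBlocks_one, Matrix.fromBlocks_neg]
  simp only [smul_mul_smul_comm, mul_assoc, hmap (S.Kp_mul_Phi_dual hη), hΦ, hΦT]
  simp only [← mul_assoc, hmap (S.transpose_Phi_mul_Kp_dual hη), mul_zero, zero_mul,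
    add_zero, zero_add, neg_mul, mul_neg, Complex.I_mul_I, neg_neg, neg_smul, one_smul,
    add_neg_cancel, neg_zero]

lemma isSpectralImage_blockSwap_dual_A (β : ℂ) :
    IsSpectralImage (fun x => -x⁻¹) (blockSwap ((S.dual hη).A β)) (S.A β) :=
  isSpectralImage_neg_inv (S.A_mul_blockSwap_dual_A hη β)

lemma roots_charpoly_A_eq_map_dual (β : ℂ) :
    (S.A β).charpoly.roots = ((S.dual hη).A β).charpoly.roots.map fun x => -x⁻¹ := by
  rw [(S.isSpectralImage_blockSwap_dual_A hη β).roots_charpoly, blockSwap,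
    Matrix.coe_reindexAlgEquiv, Matrix.charpoly_reindex]

include hη in
lemma zero_notMem_roots_charpoly_A (β : ℂ) : 0 ∉ (S.A β).charpoly.roots := by
  rw [mem_roots_charpoly]
  refine spectrum.zero_notMem ℂ (IsUnit.of_mul_eq_one (-blockSwap ((S.dual hη).A β)) ?_)
  rw [mul_neg, A_mul_blockSwap_dual_A, neg_neg]

/-! ### Low-loss/low-Q eigenvalues -/

/-- The low-loss/low-Q eigenvalue of `A(β)` as a function of `z = β⁻¹`. Its value at `z = 0` is
`0`, thanks to the conventions for division by zero. -/
def lowLossEigenvalue (j : Fin (S.dual hη).rankR) (z : ℂ) : ℂ :=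
  -((S.dual hη).highLossEigenvalue j z)⁻¹

/-- The eigenprojection of `A(z⁻¹)` for the low-loss/low-Q eigenvalue. -/
def lowLossProjection (j : Fin (S.dual hη).rankR) (z : ℂ) :
    Matrix (Fin N ⊕ Fin N) (Fin N ⊕ Fin N) ℂ :=
  blockSwap ((S.dual hη).highLossProjection j z)

lemma lowLossEigenvalue_eq (j : Fin (S.dual hη).rankR) (z : ℂ) : S.lowLossEigenvalue hη j z
    = -Complex.I * z * ((S.dual hη).pencilEigenvalue j z)⁻¹ := by
  rw [lowLossEigenvalue, highLossEigenvalue, mul_inv, mul_inv, inv_inv, inv_neg, Complex.inv_I]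
  ring

lemma lowLossEigenvalue_re (j : Fin (S.dual hη).rankR) (β : ℝ) :
    (S.lowLossEigenvalue hη j (β : ℂ)⁻¹).re = 0 := by
  rw [lowLossEigenvalue, Complex.neg_re, Complex.inv_re, highLossEigenvalue_re, zero_div, neg_zero]

variable {S hη}

lemma Generic.analyticAt_lowLossEigenvalue (hgen : (S.dual hη).Generic)
    (hz : ‖z‖ * (S.dual hη).beta0 < 1) (j : Fin (S.dual hη).rankR) :
    AnalyticAt ℂ (S.lowLossEigenvalue hη j) z := by
  rw [funext (S.lowLossEigenvalue_eq hη j)]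
  refine (analyticAt_const.mul analyticAt_id).mul
    ((hgen.analyticAt_pencilEigenvalue hz j).inv (norm_pos_iff.1 ?_))
  exact (half_pos (S.dual hη).gap_pos).trans (hgen.gap_div_two_lt_norm_pencilEigenvalue hz j)

lemma Generic.analyticAt_lowLossProjection (hgen : (S.dual hη).Generic)
    (hz : ‖z‖ * (S.dual hη).beta0 < 1) (j : Fin (S.dual hη).rankR) :
    AnalyticAt ℂ (S.lowLossProjection hη j) z :=
  ((blockSwap (n := Fin N)).toLinearMap.toContinuousLinearMap.analyticAt _).comp
    (hgen.analyticAt_highLossProjection hz j)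

lemma Generic.rank_lowLossProjection (hgen : (S.dual hη).Generic)
    (hz : ‖z‖ * (S.dual hη).beta0 < 1) (j : Fin (S.dual hη).rankR) :
    (S.lowLossProjection hη j z).rank = 1 :=
  (Matrix.rank_reindex _ _ _).trans (hgen.rank_highLossProjection hz j)

lemma Generic.isSimpleEigenprojection_lowLoss (hgen : (S.dual hη).Generic)
    (hz : ‖z‖ * (S.dual hη).beta0 < 1) (hz0 : z ≠ 0) (j : Fin (S.dual hη).rankR) :
    IsSimpleEigenprojection (S.A z⁻¹) (S.lowLossEigenvalue hη j z) (S.lowLossProjection hη j z) :=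
  (S.isSpectralImage_blockSwap_dual_A hη z⁻¹).isSimpleEigenprojection
    ((hgen.isSimpleEigenprojection_highLoss hz hz0 j).reindex _)

/-- Any larger cutoff works equally well, since the family tends to infinity. -/
lemma IsHighLossFamily.exists_pos_eventually_filter_roots {k : ℕ} {ζ : Fin k → ℂ → ℂ}
    (h : S.IsHighLossFamily ζ) : ∃ r : ℝ, 0 < r ∧ ∀ᶠ β : ℝ in atTop,
      (S.A (β : ℂ)).charpoly.roots.filter (r < ‖·‖)
        = Finset.univ.val.map (fun j => ζ j (β : ℂ)⁻¹) := by
  obtain ⟨htendsto, r, hr⟩ := h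
  refine ⟨max r 1, lt_max_of_lt_right one_pos, ?_⟩
  filter_upwards [hr, eventually_all.2 fun j => (htendsto j).eventually_gt_atTop (max r 1)]
    with β hβ hlarge
  have hfilter : (S.A (β : ℂ)).charpoly.roots.filter (max r 1 < ‖·‖)
      = ((S.A (β : ℂ)).charpoly.roots.filter (r < ‖·‖)).filter (max r 1 < ‖·‖) := by
    rw [Multiset.filter_filter]
    exact Multiset.filter_congr fun x _ => (and_iff_left_of_imp (le_max_left r 1).trans_lt).symm
  rw [hfilter, hβ, Multiset.filter_eq_self]
  intro x hx
  obtain ⟨j, _, rfl⟩ := Multiset.mem_map.1 hx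
  exact hlarge j

lemma IsHighLossFamily.isLowLossLowQFamily {k : ℕ} {ζ : Fin k → ℂ → ℂ}
    (h : (S.dual hη).IsHighLossFamily ζ) : S.IsLowLossLowQFamily fun j z => -(ζ j z)⁻¹ := by
  constructor
  · refine fun j => tendsto_zero_iff_norm_tendsto_zero.2 ?_
    simp only [norm_neg, norm_inv]
    exact (h.1 j).inv_tendsto_atTop
  · obtain ⟨r, hr0, hr⟩ := h.exists_pos_eventually_filter_roots
    refine ⟨r⁻¹, inv_pos.2 hr0, ?_⟩
    filter_upwards [hr] with β hβ
    have hiff (x : ℂ) (hx : x ∈ ((S.dual hη).A β).charpoly.roots) :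
        ‖-x⁻¹‖ < r⁻¹ ↔ r < ‖x‖ := by
      have hx0 : x ≠ 0 := by
        rintro rfl
        exact (S.dual hη).zero_notMem_roots_charpoly_A S.α_pos β hx
      rw [norm_neg, norm_inv, inv_lt_inv₀ (norm_pos_iff.2 hx0) hr0]
    rw [S.roots_charpoly_A_eq_map_dual hη, Multiset.filter_map]
    simp only [Function.comp_def, Multiset.filter_congr hiff, hβ, Multiset.map_map]

end LagrangianSystem

end

theorem mainTheorem4_general {N : ℕ} (S : LagrangianSystem N) :
    (S.Generic → ∃ (ζ : Fin S.rankR → ℂ → ℂ)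
        (P : Fin S.rankR → ℂ → Matrix (Fin N ⊕ Fin N) (Fin N ⊕ Fin N) ℂ),
      S.IsHighLossFamily ζ ∧
      (∀ j, MeromorphicAt (ζ j) 0 ∧
        AnalyticOnNhd ℂ (ζ j) (Metric.ball 0 (S.beta0)⁻¹ \ {0})) ∧
      (∀ j, (∀ a b, AnalyticOnNhd ℂ (fun z => P j z a b) (Metric.ball 0 (S.beta0)⁻¹)) ∧
        ∀ z ∈ Metric.ball (0 : ℂ) (S.beta0)⁻¹, (P j z).rank = 1) ∧
      (∀ j, ∀ z ∈ Metric.ball (0 : ℂ) (S.beta0)⁻¹ \ {0},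
        IsSimpleEigenvalue (S.A z⁻¹) (ζ j z) ∧ IsEigenprojection (S.A z⁻¹) (ζ j z) (P j z)) ∧
      (∀ j, ∀ β : ℝ, S.beta0 < β → (ζ j ((β : ℂ)⁻¹)).re = 0)) ∧
    (∀ hη : S.η.PosDef, (S.dual hη).Generic → ∃ (ζ : Fin S.rankR → ℂ → ℂ)
        (P : Fin S.rankR → ℂ → Matrix (Fin N ⊕ Fin N) (Fin N ⊕ Fin N) ℂ),
      S.IsLowLossLowQFamily ζ ∧
      (∀ j, AnalyticOnNhd ℂ (ζ j) (Metric.ball 0 (S.beta1 hη)⁻¹)) ∧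
      (∀ j, (∀ a b, AnalyticOnNhd ℂ (fun z => P j z a b) (Metric.ball 0 (S.beta1 hη)⁻¹)) ∧
        ∀ z ∈ Metric.ball (0 : ℂ) (S.beta1 hη)⁻¹, (P j z).rank = 1) ∧
      (∀ j, ∀ z ∈ Metric.ball (0 : ℂ) (S.beta1 hη)⁻¹ \ {0},
        IsSimpleEigenvalue (S.A z⁻¹) (ζ j z) ∧ IsEigenprojection (S.A z⁻¹) (ζ j z) (P j z)) ∧
      (∀ j, ∀ β : ℝ, S.beta1 hη < β →
        IsSimpleEigenvalue (S.A (β : ℂ)) (ζ j ((β : ℂ)⁻¹)) ∧ (ζ j ((β : ℂ)⁻¹)).re = 0)) := by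
  refine ⟨fun hgen => ?_, fun hη hgen => ?_⟩
  · have hball {z : ℂ} (hz : z ∈ Metric.ball 0 S.beta0⁻¹) : ‖z‖ * S.beta0 < 1 :=
      LagrangianSystem.norm_mul_beta0_lt_one_of_mem_ball le_rfl hz
    refine ⟨S.highLossEigenvalue, S.highLossProjection, hgen.isHighLossFamily, fun j => ⟨?_, ?_⟩,
      fun j => ⟨fun a b z hz => ?_, fun z hz => ?_⟩, fun j z hz => ?_, fun j β _ => ?_⟩
    · exact hgen.meromorphicAt_highLossEigenvalue (by simp) j
    · exact fun z hz => hgen.analyticAt_highLossEigenvalue (hball hz.1) hz.2 j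
    · exact analyticAt_matrix_apply (hgen.analyticAt_highLossProjection (hball hz) j) a b
    · exact hgen.rank_highLossProjection (hball hz) j
    · have h := hgen.isSimpleEigenprojection_highLoss (hball hz.1) hz.2 j
      exact ⟨h.isSimpleEigenvalue, h.isEigenprojection⟩
    · exact S.highLossEigenvalue_re j β
  · have hball {z : ℂ} (hz : z ∈ Metric.ball 0 (S.beta1 hη)⁻¹) : ‖z‖ * (S.dual hη).beta0 < 1 :=
      LagrangianSystem.norm_mul_beta0_lt_one_of_mem_ball (le_max_right _ _) hz
    refine ⟨S.lowLossEigenvalue hη, S.lowLossProjection hη,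
      hgen.isHighLossFamily.isLowLossLowQFamily, fun j z hz => ?_,
      fun j => ⟨fun a b z hz => ?_, fun z hz => ?_⟩, fun j z hz => ?_, fun j β hβ => ⟨?_, ?_⟩⟩
    · exact hgen.analyticAt_lowLossEigenvalue (hball hz) j
    · exact analyticAt_matrix_apply (hgen.analyticAt_lowLossProjection (hball hz) j) a b
    · exact hgen.rank_lowLossProjection (hball hz) j
    · have h := hgen.isSimpleEigenprojection_lowLoss (hball hz.1) hz.2 j
      exact ⟨h.isSimpleEigenvalue, h.isEigenprojection⟩
    · have hβ' : (S.dual hη).beta0 < β := (le_max_right _ _).trans_lt hβ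
      simpa only [inv_inv] using (hgen.isSimpleEigenprojection_lowLoss
        (LagrangianSystem.norm_inv_mul_beta0_lt_one hβ')
        (LagrangianSystem.inv_ofReal_ne_zero hβ') j).isSimpleEigenvalue
    · exact S.lowLossEigenvalue_re hη j β

theorem mainTheorem4 {N : ℕ} (S : LagrangianSystem N) (hη : S.η.PosDef)
    (hgen : S.Generic) (hgen_dual : (S.dual hη).Generic) :
    -- the high-loss eigenvalues
    (∃ (ζ : Fin S.rankR → ℂ → ℂ)
        (P : Fin S.rankR → ℂ → Matrix (Fin N ⊕ Fin N) (Fin N ⊕ Fin N) ℂ),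
      S.IsHighLossFamily ζ ∧
      (∀ j, MeromorphicAt (ζ j) 0 ∧
        AnalyticOnNhd ℂ (ζ j) (Metric.ball 0 (S.beta0)⁻¹ \ {0})) ∧
      (∀ j, (∀ a b, AnalyticOnNhd ℂ (fun z => P j z a b) (Metric.ball 0 (S.beta0)⁻¹)) ∧
        ∀ z ∈ Metric.ball (0 : ℂ) (S.beta0)⁻¹, (P j z).rank = 1) ∧
      (∀ j, ∀ z ∈ Metric.ball (0 : ℂ) (S.beta0)⁻¹ \ {0},
        IsSimpleEigenvalue (S.A z⁻¹) (ζ j z) ∧ IsEigenprojection (S.A z⁻¹) (ζ j z) (P j z)) ∧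
      (∀ j, ∀ β : ℝ, S.beta0 < β → (ζ j ((β : ℂ)⁻¹)).re = 0)) ∧
    -- the low-loss/low-Q eigenvalues
    (∃ (ζ : Fin S.rankR → ℂ → ℂ)
        (P : Fin S.rankR → ℂ → Matrix (Fin N ⊕ Fin N) (Fin N ⊕ Fin N) ℂ),
      S.IsLowLossLowQFamily ζ ∧
      (∀ j, AnalyticOnNhd ℂ (ζ j) (Metric.ball 0 (S.beta1 hη)⁻¹)) ∧
      (∀ j, (∀ a b, AnalyticOnNhd ℂ (fun z => P j z a b) (Metric.ball 0 (S.beta1 hη)⁻¹)) ∧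
        ∀ z ∈ Metric.ball (0 : ℂ) (S.beta1 hη)⁻¹, (P j z).rank = 1) ∧
      (∀ j, ∀ z ∈ Metric.ball (0 : ℂ) (S.beta1 hη)⁻¹ \ {0},
        IsSimpleEigenvalue (S.A z⁻¹) (ζ j z) ∧ IsEigenprojection (S.A z⁻¹) (ζ j z) (P j z)) ∧
      (∀ j, ∀ β : ℝ, S.beta1 hη < β →
        IsSimpleEigenvalue (S.A (β : ℂ)) (ζ j ((β : ℂ)⁻¹)) ∧ (ζ j ((β : ℂ)⁻¹)).re = 0)) := by
  exact ⟨(mainTheorem4_general S).1 hgen, (mainTheorem4_general S).2 hη hgen_dual⟩
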